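/- Let $\mathcal X$ be a Polish space, $\alpha>0$, and let $\Xi$ be a probability measure on $(0,\infty)\times\mathcal X$. Let $(d_n)_{n\ge1}$ be i.i.d. $\operatorname{Exp}(\alpha)$ random variables (dormant periods) and, independently, $((a_n,\chi_n))_{n\ge1}$ i.i.d. with law $\Xi$ (active periods with their states); assume $\mathbb E[a_1]<\infty$. Put $T_n=d_n+a_n$, $S_n=T_1+\dots+T_n$ ($S_0=0$), and let $$\eta=\sum_{n\ge1}\delta_{(S_{n-1}+d_n,\;S_n,\;\chi_n)}$$ be the resulting point process on $\triangle\times\mathcal X$, $\triangle=\{(s,t)\in\mathbb R^2:s<t\}$. A configuration is called dormant at $t$ if it has no point $(s,e,x)$ with $s\le t<e$. For $t\in\mathbb R$ let $\theta_t$ be the translation of configurations by $-t$ in time, and for $a\le b$ let $R_a^b$ be the restriction to the points $(s,e,x)$ with $[s,e]\cap[a,b]\neq\emptyset$. For $t>0$ let $\Gamma_{\alpha,t}^\Xi$ be the law of $R_{-t}^t\theta_t\eta$ conditionally on $\{\eta\text{ is dormant at }2t\}$. Let $E:\mathcal X\to\mathbb R\cup\{-\infty\}$ be measurable, $\mathcal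 H\big(\sum_{k=1}^n\delta_{(s_k,t_k,x_k)}\big)=\sum_{k=1}^nE(x_k)$, $e^{\infty}=\infty$, $e^{-\infty}=0$, and define for $t>0$ $$\mathbf Z_{2t}=\int e^{-\mathcal H(\zeta)}\,\Gamma_{\alpha,t}^\Xi(\mathrm d\zeta).$$ Assume that $t\mapsto\mathbf Z_t$ is locally bounded, i.e. bounded on $(0,t_0]$ for every $t_0>0$, and set $\widehat\Gamma_{\alpha,t}^\Xi(\mathrm d\zeta)=\mathbf Z_{2t}^{-1}e^{-\mathcal H(\zeta)}\,\Gamma_{\alpha,t}^\Xi(\mathrm d\zeta)$. Then the limit $\varphi=\lim_{t\to\infty}\log(\mathbf Z_t)/t$ exists in $\mathbb R\cup\{\infty\}$, and the following conditions are equivalent: 1. there exists $\lambda\in\mathbb R$ such that $\mathbb E\big[e^{-\lambda T_1-E(\chi_1)}\big]=1$ and $\mathbb E\big[T_1e^{-\lambda T_1-E(\chi_1)}\big]<\infty$; 2. $\limsup_{t\to\infty}\mathbf Z_{2t}/\mathbf Z_t^2<\infty$; 3. $\liminf_{t\to\infty}\widehat\Gamma_{\alpha,t}^\Xi(\text{dormant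 at }0)>0$; 4. $\liminf_{t\to\infty}\mathbf Z_te^{-\varphi t}>0$. If these conditions hold, then $\varphi<\infty$ and $\lambda=\varphi$ is the unique real number satisfying condition 1. Moreover, for $\lambda=\varphi$, $\alpha+\lambda>0$, $$\widehat\Xi(\mathrm da\,\mathrm d\chi)=\tfrac{\alpha}{\alpha+\lambda}e^{-\lambda a-E(\chi)}\,\Xi(\mathrm da\,\mathrm d\chi)$$ is a probability measure, and with $\hat{\mathbb E}[\widehat T_1]$ denoting the expectation of $\widehat T_1=\hat d_1+\hat a_1$, where $\hat d_1\sim\operatorname{Exp}(\alpha+\lambda)$ and $(\hat a_1,\hat\chi_1)\sim\widehat\Xi$, one has $\hat{\mathbb E}[\widehat T_1]<\infty$ and $$\lim_{t\to\infty}\mathbf Z_te^{-\varphi t}=\frac{\alpha}{\alpha+\lambda}\,\frac{\mathbb E[T_1]}{\hat{\mathbb E}[\widehat T_1]}.$$ -/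

import Mathlib

open MeasureTheory Filter Topology
open scoped ENNReal

noncomputable section

namespace AlternatingProcess

/-- The set `△ = {(s, t) ∈ ℝ² : s < t}` of non-degenerate intervals `[s, t]`. -/
abbrev Triangle : Type := {p : ℝ × ℝ // p.1 < p.2}

/-- Configurations of marked intervals: measures on `△ × X`, with the σ-algebra generated by the
evaluations `μ ↦ μ B`. A point configuration `∑ i, δ_(sᵢ, tᵢ, xᵢ)` is the corresponding counting
measure, and all laws below are carried by such measures. -/
abbrev Config (X : Type*) [MeasurableSpace X] : Type _ := Measure (Triangle × X)

variable {X : Type*} [MeasurableSpace X]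

/-- The law of one cycle `(d, (a, χ))`: the dormant period `d` is `Exp(α)` distributed and independent
of the pair `(a, χ) ∼ Ξ` of an active period `a > 0` and its state `χ`. -/
def cycleLaw (α : ℝ) (Ξ : Measure (Set.Ioi (0 : ℝ) × X)) :
    Measure (ℝ × (Set.Ioi (0 : ℝ) × X)) :=
  (ProbabilityTheory.expMeasure α).prod Ξ

/-- The law of an iid sequence of cycles `((d₁, a₁, χ₁), (d₂, a₂, χ₂), …)`; the sequence is indexed
from `0`. -/
def seqLaw (α : ℝ) (Ξ : Measure (Set.Ioi (0 : ℝ) × X)) :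
    Measure (ℕ → ℝ × (Set.Ioi (0 : ℝ) × X)) :=
  Measure.infinitePi (fun _ => cycleLaw α Ξ)

/-- The length `T = d + a` of a cycle. -/
def cycleLength (c : ℝ × (Set.Ioi (0 : ℝ) × X)) : ℝ := c.1 + (c.2.1 : ℝ)

/-- The embedded renewal process `S_n = ∑_{k ≤ n} (d_k + a_k)`. -/
def renewalPoint (ω : ℕ → ℝ × (Set.Ioi (0 : ℝ) × X)) (n : ℕ) : ℝ :=
  ∑ k ∈ Finset.range n, cycleLength (ω k)

/-- The `n`-th active period as an element of `△`: it starts at `S_n + d_{n+1}` and ends at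
`S_{n+1} = S_n + d_{n+1} + a_{n+1}`. -/
def activeInterval (ω : ℕ → ℝ × (Set.Ioi (0 : ℝ) × X)) (n : ℕ) : Triangle :=
  ⟨(renewalPoint ω n + (ω n).1, renewalPoint ω (n + 1)), by
    have h : (0 : ℝ) < ((ω n).2.1 : ℝ) := (ω n).2.1.2
    simp only [renewalPoint, Finset.sum_range_succ, cycleLength]
    linarith⟩

/-- The alternating point process `η = ∑ n, δ_(X_{2n-1}, X_{2n}, χ_n)`. -/
def eta (ω : ℕ → ℝ × (Set.Ioi (0 : ℝ) × X)) : Config X :=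
  Measure.sum fun n => Measure.dirac (activeInterval ω n, (ω n).2.2)

/-- The marked intervals `(s, e, x)` with `[s, e] ∩ [a, b] ≠ ∅`. -/
def meets (X : Type*) (a b : ℝ) : Set (Triangle × X) :=
  {p | (Set.Icc p.1.1.1 p.1.1.2 ∩ Set.Icc a b).Nonempty}

/-- `R_a^b`: restriction to all marked intervals that intersect `[a, b]`. -/
def restr (a b : ℝ) (ζ : Config X) : Config X := ζ.restrict (meets X a b)

/-- Translation of a marked interval by `-t`. -/
def shiftPoint (t : ℝ) (p : Triangle × X) : Triangle × X :=
  (⟨(p.1.1.1 - t, p.1.1.2 - t), by linarith [p.1.2]⟩, p.2)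

/-- `θ_t`: translation of a configuration by `-t`. -/
def shift (t : ℝ) (ζ : Config X) : Config X := ζ.map (shiftPoint t)

/-- The configurations that are dormant at time `t`: no marked interval `(s, e, x)` satisfies
`s ≤ t < e`. -/
def dormantAt (X : Type*) [MeasurableSpace X] (t : ℝ) : Set (Config X) :=
  {ζ | ζ {p | p.1.1.1 ≤ t ∧ t < p.1.1.2} = 0}

/-- `Γ_{α, t}^Ξ`: the law of `R_{-t}^t θ_t η` conditionally on `η` being dormant at `2 t`. -/
def gammaLaw (α : ℝ) (Ξ : Measure (Set.Ioi (0 : ℝ) × X)) (t : ℝ) : Measure (Config X) :=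
  (ProbabilityTheory.cond (seqLaw α Ξ) {ω | eta ω ∈ dormantAt X (2 * t)}).map
    fun ω => restr (-t) t (shift t (eta ω))

/-- The Hamiltonian `H(∑ k, δ_(s_k, t_k, x_k)) = ∑ k, E(x_k)`, as the integral of `E` against the
configuration, i.e. the integral of the positive part minus that of the negative part. For a finite
configuration and `E < ∞` the first integral is finite. -/
def hamiltonian (E : X → EReal) (ζ : Config X) : EReal :=
  ((∫⁻ p, (E p.2).toENNReal ∂ζ : ℝ≥0∞) : EReal) -
    ((∫⁻ p, (-E p.2).toENNReal ∂ζ : ℝ≥0∞) : EReal)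

/-- The Boltzmann weight `e^{-H(ζ)} ∈ [0, ∞]`, with `e^∞ = ∞`. -/
def boltzmann (E : X → EReal) (ζ : Config X) : ℝ≥0∞ := EReal.exp (-hamiltonian E ζ)

/-- The partition function `Z_t`, given by `Z_{2t} = ∫ e^{-H} dΓ_{α, t}^Ξ`. -/
def partitionFn (α : ℝ) (Ξ : Measure (Set.Ioi (0 : ℝ) × X)) (E : X → EReal) (t : ℝ) : ℝ≥0∞ :=
  ∫⁻ ζ, boltzmann E ζ ∂(gammaLaw α Ξ (t / 2))

/-- The Gibbs measure `dΓ̂_{α, t}^Ξ = Z_{2t}⁻¹ e^{-H} dΓ_{α, t}^Ξ`. -/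
def gibbsLaw (α : ℝ) (Ξ : Measure (Set.Ioi (0 : ℝ) × X)) (E : X → EReal) (t : ℝ) :
    Measure (Config X) :=
  (partitionFn α Ξ E (2 * t))⁻¹ • (gammaLaw α Ξ t).withDensity (boltzmann E)

/-- The exponential growth rate `φ = lim_{t → ∞} log(Z_t) / t`. -/
def freeEnergy (α : ℝ) (Ξ : Measure (Set.Ioi (0 : ℝ) × X)) (E : X → EReal) : EReal :=
  limUnder atTop fun t : ℝ => ENNReal.log (partitionFn α Ξ E t) / (t : EReal)

/-- The expected cycle length `𝔼[T₁] = 𝔼[d₁ + a₁]` for dormant periods `Exp(α)` and active periods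
with law `Ξ`. -/
def meanCycle (α : ℝ) (Ξ : Measure (Set.Ioi (0 : ℝ) × X)) : ℝ≥0∞ :=
  ∫⁻ c, ENNReal.ofReal (cycleLength c) ∂(cycleLaw α Ξ)

/-- The tilting weight `e^{-lam T - E(χ)}` of a cycle. -/
def tiltWeight (E : X → EReal) (lam : ℝ) (c : ℝ × (Set.Ioi (0 : ℝ) × X)) : ℝ≥0∞ :=
  EReal.exp (((-lam * cycleLength c : ℝ) : EReal) - E c.2.2)

/-- The tilting condition: `𝔼[e^{-lam T₁ - E(χ₁)}] = 1` and `𝔼[T₁ e^{-lam T₁ - E(χ₁)}] < ∞`. -/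
def IsTilting (α : ℝ) (Ξ : Measure (Set.Ioi (0 : ℝ) × X)) (E : X → EReal) (lam : ℝ) : Prop :=
  ∫⁻ c, tiltWeight E lam c ∂(cycleLaw α Ξ) = 1 ∧
    ∫⁻ c, ENNReal.ofReal (cycleLength c) * tiltWeight E lam c ∂(cycleLaw α Ξ) < ∞

/-- The tilted law `Ξ̂(da dχ) = α / (α + lam) e^{-lam a - E(χ)} Ξ(da dχ)`. -/
def tiltedLaw (α : ℝ) (Ξ : Measure (Set.Ioi (0 : ℝ) × X)) (E : X → EReal) (lam : ℝ) :
    Measure (Set.Ioi (0 : ℝ) × X) :=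
  ENNReal.ofReal (α / (α + lam)) •
    Ξ.withDensity fun q => EReal.exp (((-lam * (q.1 : ℝ) : ℝ) : EReal) - E q.2)

end AlternatingProcess

end

open MeasureTheory Filter Topology
open scoped ENNReal

noncomputable section

/-! Let A(t) be the expectation of ∏ e^{-E(χ_k)} over the completed active periods, on the event of
dormancy at t (`dormantMass` with `stateWeight`), and D(t) the probability of that event
(`dormantProb`). Given dormancy at the end of the window, the window shows exactly the completed
periods, so Z_t = A(t)/D(t) (`partitionFn_eq`). Dormant periods are memoryless, so a dormant time is
a regeneration time: paths dormant at both s and s+t have weight A(s)A(t)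
(`lintegral_dormant_inter`). Hence A is supermultiplicative, and the Gibbs probability of dormancy
at 0 is A(t)²/A(2t). Fekete's lemma gives a rate φ for A, with A(t) ≤ e^{φt} when φ < ∞; since D has
a positive limit, Z has the same rate.

2 ⇔ 3: both say A(2t) ≤ C A(t)² for large t. 3 ⇒ 4: iterating this bound along t, 2t, 4t, ...
excludes φ = ∞ and yields A(t) ≥ C⁻¹e^{φt} for large t. 4 ⇒ 3: compare c e^{φt} ≤ A(t) with A(2t) ≤
e^{2φt}.

1 ⇒ 4: tilting cycles by e^{-λT-E(χ)} gives another alternating process, with parameters α+λ and Ξ̂,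
whose dormancy probability is e^{-λt}A(t) (`dormantProb_tiltedLaw`). The renewal theorem for this
process and for the original one gives the sharp asymptotics, so λ must be φ, which also proves
uniqueness.

4 ⇒ 1: with m(λ) = 𝔼[e^{-λT-E(χ)}], the Laplace transform of A is 1/((α+λ)(1-m(λ))). The bounds
κe^{φt} ≤ A(t) ≤ e^{φt} place it between κ/(λ-φ) and 1/(λ-φ) for λ > φ, so m(λ) < 1 and 1-m(λ) =
O(λ-φ). Letting λ decrease to φ gives m(φ) = 1 and a finite one-sided derivative, the tilted mean of
T (`isTilting_of_bounds`).

The renewal theorem (`tendsto_dormantProb`) uses the exponential density in the cycle length: if D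
is near its upper limit along suitable times, it is near it at almost all earlier lags, and the
identity "dormant or active at t" then determines the upper limit. The same argument for -D
determines the lower limit. -/

namespace AlternatingProcess

/-! ### First-step analysis of the iid cycles and regeneration at dormant times. -/

section Sequences

variable {X : Type*} [MeasurableSpace X]

/-- The sequence with first term `c`, followed by the terms of `ω`. -/
def consSeq {Y : Type*} (c : Y) (ω : ℕ → Y) : ℕ → Y
  | 0 => c
  | n + 1 => ω n

@[simp] lemma consSeq_zero {Y : Type*} (c : Y) (ω : ℕ → Y) : consSeq c ω 0 = c := rfl

@[simp] lemma consSeq_succ {Y : Type*} (c : Y) (ω : ℕ → Y) (n : ℕ) :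
    consSeq c ω (n + 1) = ω n := rfl

lemma measurable_consSeq {Y : Type*} [MeasurableSpace Y] :
    Measurable fun p : Y × (ℕ → Y) => consSeq p.1 p.2 := by
  refine measurable_pi_lambda _ fun n => ?_
  cases n with
  | zero => exact measurable_fst
  | succ n => exact (measurable_pi_apply n).comp measurable_snd

/-- Prepending an independent cycle preserves the iid law. This is the source of all inductions on
the number of cycles; it suffices to compare masses of finite-dimensional boxes. -/
lemma map_consSeq_infinitePi {Y : Type*} [MeasurableSpace Y] (μ : Measure Y)
    [IsProbabilityMeasure μ] :
    (μ.prod (Measure.infinitePi fun _ : ℕ => μ)).map (fun p => consSeq p.1 p.2) =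
      Measure.infinitePi fun _ : ℕ => μ := by
  classical
  refine Measure.eq_infinitePi _ fun s t ht => ?_
  obtain ⟨N, hN⟩ : ∃ N, s ⊆ Finset.range (N + 1) :=
    ⟨s.sup id, fun i hi => Finset.mem_range.2 (Nat.lt_succ_of_le (Finset.le_sup (f := id) hi))⟩
  -- Filling missing coordinates with `Set.univ` makes the box live on an initial segment, where the
  -- coordinate 0 can be split off.
  let t' : ℕ → Set Y := fun i => if i ∈ s then t i else Set.univ
  have ht' : ∀ i, MeasurableSet (t' i) := fun i => by
    dsimp only [t']; split_ifs
    exacts [ht i, MeasurableSet.univ]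
  have h1 : (s : Set ℕ).pi t = (Finset.range (N + 1) : Set ℕ).pi t' := by
    ext x
    simp only [Set.mem_pi, t']
    constructor
    · intro h i _
      split_ifs with hi
      exacts [h i hi, trivial]
    · intro h i hi
      have h2 := h i (hN hi)
      have hi' : i ∈ s := hi
      rwa [if_pos hi'] at h2
  have h2 : ∏ i ∈ s, μ (t i) = ∏ i ∈ Finset.range (N + 1), μ (t' i) := by
    rw [← Finset.prod_subset hN]
    · exact Finset.prod_congr rfl fun i hi => by simp only [t', if_pos hi]
    · intro i _ hi
      simp only [t', if_neg hi, measure_univ]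
  have h3 : (fun p : Y × (ℕ → Y) => consSeq p.1 p.2) ⁻¹' (Finset.range (N + 1) : Set ℕ).pi t' =
      t' 0 ×ˢ (Finset.range N : Set ℕ).pi fun i => t' (i + 1) := by
    ext ⟨c, ω⟩
    simp only [Set.mem_preimage, Set.mem_pi, Finset.mem_coe, Finset.mem_range, Set.mem_prod]
    constructor
    · intro h
      exact ⟨h 0 (by omega), fun i hi => h (i + 1) (by omega)⟩
    · rintro ⟨h0, h⟩ i hi
      cases i with
      | zero => exact h0
      | succ i => exact h i (by omega)
  rw [h1, h2, Measure.map_apply measurable_consSeq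
      (MeasurableSet.pi (Finset.countable_toSet _) fun i _ => ht' i), h3, Measure.prod_prod,
    Measure.infinitePi_pi _ (fun i _ => ht' (i + 1)), Finset.prod_range_succ', mul_comm]

lemma isProbabilityMeasure_cycleLaw {α : ℝ} (hα : 0 < α) (Ξ : Measure (Set.Ioi (0 : ℝ) × X))
    [IsProbabilityMeasure Ξ] : IsProbabilityMeasure (cycleLaw α Ξ) := by
  have := ProbabilityTheory.isProbabilityMeasure_expMeasure hα
  unfold cycleLaw
  infer_instance

lemma lintegral_seqLaw {α : ℝ} (hα : 0 < α) (Ξ : Measure (Set.Ioi (0 : ℝ) × X))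
    [IsProbabilityMeasure Ξ] {F : (ℕ → ℝ × (Set.Ioi (0 : ℝ) × X)) → ℝ≥0∞} (hF : Measurable F) :
    ∫⁻ ω, F ω ∂seqLaw α Ξ = ∫⁻ c, ∫⁻ ω, F (consSeq c ω) ∂seqLaw α Ξ ∂cycleLaw α Ξ := by
  have := isProbabilityMeasure_cycleLaw hα Ξ
  conv_lhs => rw [seqLaw, ← map_consSeq_infinitePi (cycleLaw α Ξ)]
  rw [lintegral_map hF measurable_consSeq]
  exact lintegral_prod _ (hF.comp measurable_consSeq).aemeasurable

lemma measurable_cycleLength :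
    Measurable (cycleLength : ℝ × (Set.Ioi (0 : ℝ) × X) → ℝ) := by
  unfold cycleLength; fun_prop

@[fun_prop]
lemma measurable_renewalPoint (n : ℕ) :
    Measurable fun ω : ℕ → ℝ × (Set.Ioi (0 : ℝ) × X) => renewalPoint ω n := by
  unfold renewalPoint
  exact Finset.measurable_sum _ fun k _ => measurable_cycleLength.comp (measurable_pi_apply k)

omit [MeasurableSpace X] in
lemma renewalPoint_consSeq_succ (c : ℝ × (Set.Ioi (0 : ℝ) × X))
    (ω : ℕ → ℝ × (Set.Ioi (0 : ℝ) × X)) (n : ℕ) :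
    renewalPoint (consSeq c ω) (n + 1) = cycleLength c + renewalPoint ω n := by
  simp [renewalPoint, Finset.sum_range_succ', add_comm]

omit [MeasurableSpace X] in
@[simp] lemma renewalPoint_zero (ω : ℕ → ℝ × (Set.Ioi (0 : ℝ) × X)) : renewalPoint ω 0 = 0 := by
  simp [renewalPoint]

omit [MeasurableSpace X] in
lemma renewalPoint_succ (ω : ℕ → ℝ × (Set.Ioi (0 : ℝ) × X)) (n : ℕ) :
    renewalPoint ω (n + 1) = renewalPoint ω n + cycleLength (ω n) := by
  simp [renewalPoint, Finset.sum_range_succ]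

/-- The event that `t` lies in the dormant period that follows the `n`-th renewal point. -/
def dormantEvent (n : ℕ) (t : ℝ) : Set (ℕ → ℝ × (Set.Ioi (0 : ℝ) × X)) :=
  {ω | renewalPoint ω n ≤ t ∧ t < renewalPoint ω n + (ω n).1}

/-- The product of the weights of the first `n` active periods. -/
def weightProd (w : X → ℝ≥0∞) (n : ℕ) (ω : ℕ → ℝ × (Set.Ioi (0 : ℝ) × X)) : ℝ≥0∞ :=
  ∏ k ∈ Finset.range n, w (ω k).2.2

lemma measurable_weightProd {w : X → ℝ≥0∞} (hw : Measurable w) (n : ℕ) :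
    Measurable (weightProd w n) := by
  unfold weightProd
  exact Finset.measurable_prod _ fun k _ => by fun_prop

omit [MeasurableSpace X] in
lemma weightProd_consSeq_succ (w : X → ℝ≥0∞) (c : ℝ × (Set.Ioi (0 : ℝ) × X))
    (ω : ℕ → ℝ × (Set.Ioi (0 : ℝ) × X)) (n : ℕ) :
    weightProd w (n + 1) (consSeq c ω) = w c.2.2 * weightProd w n ω := by
  simp [weightProd, Finset.prod_range_succ', mul_comm]

lemma measurableSet_dormantEvent (n : ℕ) (t : ℝ) :
    MeasurableSet (dormantEvent n t : Set (ℕ → ℝ × (Set.Ioi (0 : ℝ) × X))) := by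
  unfold dormantEvent
  have h := measurable_renewalPoint (X := X) n
  exact (measurableSet_le h measurable_const).inter
    (measurableSet_lt measurable_const (h.add (measurable_pi_apply n).fst))

omit [MeasurableSpace X] in
lemma consSeq_mem_dormantEvent_succ (c : ℝ × (Set.Ioi (0 : ℝ) × X))
    (ω : ℕ → ℝ × (Set.Ioi (0 : ℝ) × X)) (n : ℕ) (t : ℝ) :
    consSeq c ω ∈ dormantEvent (n + 1) t ↔ ω ∈ dormantEvent n (t - cycleLength c) := by
  simp only [dormantEvent, Set.mem_ofPred_eq, renewalPoint_consSeq_succ, consSeq_succ]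
  constructor <;> rintro ⟨h1, h2⟩ <;> constructor <;> linarith

lemma indicator_eq_mul_indicator {A B : Type*} {S : Set A} {S' : Set B} {f : A → ℝ≥0∞}
    {g : B → ℝ≥0∞} {a : A} {b : B} {r : ℝ≥0∞} (h : a ∈ S ↔ b ∈ S') (hf : f a = r * g b) :
    S.indicator f a = r * S'.indicator g b := by
  by_cases ha : a ∈ S
  · rw [Set.indicator_of_mem ha, Set.indicator_of_mem (h.1 ha), hf]
  · rw [Set.indicator_of_notMem ha, Set.indicator_of_notMem fun hb => ha (h.2 hb), mul_zero]

/-- The expected weight of the paths that are dormant at `t` after exactly `n` active periods,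
defined through the renewal recursion. -/
def dormantTerm (α : ℝ) (Ξ : Measure (Set.Ioi (0 : ℝ) × X)) (w : X → ℝ≥0∞) : ℕ → ℝ → ℝ≥0∞
  | 0, t => if 0 ≤ t then ENNReal.ofReal (Real.exp (-(α * t))) else 0
  | n + 1, t => ∫⁻ c, w c.2.2 * dormantTerm α Ξ w n (t - cycleLength c) ∂cycleLaw α Ξ

/-- The expected weight of the paths that are dormant at `t`. -/
def dormantMass (α : ℝ) (Ξ : Measure (Set.Ioi (0 : ℝ) × X)) (w : X → ℝ≥0∞) (t : ℝ) : ℝ≥0∞ :=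
  ∑' n, dormantTerm α Ξ w n t

lemma measurable_dormantTerm {α : ℝ} (hα : 0 < α) (Ξ : Measure (Set.Ioi (0 : ℝ) × X))
    [IsProbabilityMeasure Ξ] {w : X → ℝ≥0∞} (hw : Measurable w) (n : ℕ) :
    Measurable (dormantTerm α Ξ w n) := by
  have := isProbabilityMeasure_cycleLaw hα Ξ
  induction n with
  | zero =>
    exact Measurable.ite measurableSet_Ici (by fun_prop) measurable_const
  | succ n ih =>
    refine Measurable.lintegral_prod_right'
      (f := fun p : ℝ × (ℝ × (Set.Ioi (0 : ℝ) × X)) =>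
        w p.2.2.2 * dormantTerm α Ξ w n (p.1 - cycleLength p.2)) ?_
    have h := measurable_cycleLength (X := X)
    exact (by fun_prop : Measurable fun p : ℝ × (ℝ × (Set.Ioi (0 : ℝ) × X)) => w p.2.2.2).mul
      (ih.comp (measurable_fst.sub (h.comp measurable_snd)))

lemma measurable_dormantMass {α : ℝ} (hα : 0 < α) (Ξ : Measure (Set.Ioi (0 : ℝ) × X))
    [IsProbabilityMeasure Ξ] {w : X → ℝ≥0∞} (hw : Measurable w) :
    Measurable (dormantMass α Ξ w) := by
  unfold dormantMass
  exact Measurable.tsum fun n => measurable_dormantTerm hα Ξ hw n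

/-- The integral against the exponential law in terms of its density. -/
lemma lintegral_expMeasure {α : ℝ} {f : ℝ → ℝ≥0∞} (hf : Measurable f) :
    ∫⁻ d, f d ∂ProbabilityTheory.expMeasure α =
      ∫⁻ d in Set.Ici 0, ENNReal.ofReal (α * Real.exp (-(α * d))) * f d := by
  have h : ProbabilityTheory.expMeasure α =
      volume.withDensity (ProbabilityTheory.exponentialPDF α) := rfl
  rw [h, lintegral_withDensity_eq_lintegral_mul _ _ hf, ← lintegral_indicator measurableSet_Ici]
  · refine lintegral_congr fun d => ?_
    by_cases hd : 0 ≤ d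
    · simp [ProbabilityTheory.exponentialPDF_of_nonneg hd, hd]
    · simp [ProbabilityTheory.exponentialPDF_of_neg (not_le.1 hd), hd]
  · unfold ProbabilityTheory.exponentialPDF
    fun_prop

lemma ae_nonneg_expMeasure (α : ℝ) : ∀ᵐ d ∂ProbabilityTheory.expMeasure α, 0 ≤ d := by
  have h : ∫⁻ d, (Set.Iio (0 : ℝ)).indicator 1 d ∂ProbabilityTheory.expMeasure α = 0 := by
    rw [lintegral_expMeasure (measurable_one.indicator measurableSet_Iio), setLIntegral_congr_fun
      (g := fun _ => 0) measurableSet_Ici]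
    · simp
    · intro d hd
      have : ¬ d < 0 := not_lt.2 hd
      simp [this]
  rw [lintegral_indicator_one measurableSet_Iio] at h
  rw [ae_iff]
  convert! h using 2
  ext; simp

/-- The exponential law is memoryless. -/
lemma lintegral_expMeasure_tail {α : ℝ} {s : ℝ} (hs : 0 ≤ s) {f : ℝ → ℝ≥0∞}
    (hf : Measurable f) :
    ∫⁻ d, (if s < d then f (d - s) else 0) ∂ProbabilityTheory.expMeasure α =
      ENNReal.ofReal (Real.exp (-(α * s))) * ∫⁻ d, f d ∂ProbabilityTheory.expMeasure α := by
  have hm : Measurable fun d : ℝ => if s < d then f (d - s) else 0 :=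
    Measurable.ite measurableSet_Ioi (by fun_prop) measurable_const
  rw [lintegral_expMeasure hm, lintegral_expMeasure hf, ← lintegral_const_mul _ (by fun_prop),
    ← lintegral_indicator measurableSet_Ici, setLIntegral_congr (Ioi_ae_eq_Ici.symm),
    ← lintegral_indicator measurableSet_Ioi]
  rw [← lintegral_add_right_eq_self _ s]
  refine lintegral_congr fun d => ?_
  by_cases hd : 0 < d
  · have h1 : 0 ≤ d + s := by linarith
    simp only [Set.indicator, Set.mem_Ici, h1, if_true, Set.mem_Ioi, hd, lt_add_iff_pos_left,
      add_sub_cancel_right]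
    rw [← mul_assoc, ← ENNReal.ofReal_mul (Real.exp_pos _).le]
    congr 2
    rw [mul_left_comm, ← Real.exp_add]
    ring_nf
  · simp [Set.indicator, hd]

lemma seqLaw_isProbabilityMeasure {α : ℝ} (hα : 0 < α) (Ξ : Measure (Set.Ioi (0 : ℝ) × X))
    [IsProbabilityMeasure Ξ] : IsProbabilityMeasure (seqLaw α Ξ) := by
  have := isProbabilityMeasure_cycleLaw hα Ξ
  unfold seqLaw
  infer_instance

/-- Memorylessness for a whole cycle: given that the first dormant period survives s, the residual
cycle is a fresh one, because the active part is independent of it. -/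
lemma lintegral_cycleLaw_dormant {α : ℝ} (hα : 0 < α) (Ξ : Measure (Set.Ioi (0 : ℝ) × X))
    [IsProbabilityMeasure Ξ] {s : ℝ} (hs : 0 ≤ s) {f : ℝ × (Set.Ioi (0 : ℝ) × X) → ℝ≥0∞}
    (hf : Measurable f) :
    ∫⁻ c, (if s < c.1 then f (c.1 - s, c.2) else 0) ∂cycleLaw α Ξ =
      ENNReal.ofReal (Real.exp (-(α * s))) * ∫⁻ c, f c ∂cycleLaw α Ξ := by
  have := ProbabilityTheory.isProbabilityMeasure_expMeasure hα
  have hm : Measurable fun c : ℝ × (Set.Ioi (0 : ℝ) × X) =>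
      if s < c.1 then f (c.1 - s, c.2) else 0 :=
    Measurable.ite (measurableSet_lt measurable_const measurable_fst) (by fun_prop)
      measurable_const
  rw [cycleLaw, lintegral_prod_symm _ hm.aemeasurable, lintegral_prod_symm _ hf.aemeasurable,
    ← lintegral_const_mul _ hf.lintegral_prod_left']
  refine lintegral_congr fun q => ?_
  exact lintegral_expMeasure_tail hs (f := fun d => f (d, q)) (by fun_prop)

lemma lintegral_indicator_dormantEvent {α : ℝ} (hα : 0 < α)
    (Ξ : Measure (Set.Ioi (0 : ℝ) × X)) [IsProbabilityMeasure Ξ] {w : X → ℝ≥0∞}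
    (hw : Measurable w) (n : ℕ) (t : ℝ) :
    ∫⁻ ω, (dormantEvent n t).indicator (weightProd w n) ω ∂seqLaw α Ξ =
      dormantTerm α Ξ w n t := by
  have := seqLaw_isProbabilityMeasure hα Ξ
  have := isProbabilityMeasure_cycleLaw hα Ξ
  induction n generalizing t with
  | zero =>
    rw [lintegral_seqLaw hα Ξ
      ((measurable_weightProd hw 0).indicator (measurableSet_dormantEvent 0 t))]
    by_cases ht : 0 ≤ t
    · have h := lintegral_cycleLaw_dormant hα Ξ ht (f := fun _ => 1) measurable_const
      rw [lintegral_one, measure_univ, mul_one] at h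
      rw [dormantTerm, if_pos ht, ← h]
      refine lintegral_congr fun c => ?_
      simp [Set.indicator, dormantEvent, weightProd, ht]
    · simp [dormantTerm, Set.indicator, dormantEvent, ht]
  | succ n ih =>
    rw [lintegral_seqLaw hα Ξ
      ((measurable_weightProd hw _).indicator (measurableSet_dormantEvent _ t)), dormantTerm]
    refine lintegral_congr fun c => ?_
    rw [← ih, ← lintegral_const_mul _
      ((measurable_weightProd hw _).indicator (measurableSet_dormantEvent _ _))]
    refine lintegral_congr fun ω => ?_
    exact indicator_eq_mul_indicator (consSeq_mem_dormantEvent_succ c ω n t)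
      (weightProd_consSeq_succ w c ω n)

/-- Regeneration at a dormant time. Induction on n removes the cycles completed before s; for n = 0,
memorylessness restarts the current cycle at s. -/
lemma lintegral_indicator_dormantEvent_inter {α : ℝ} (hα : 0 < α)
    (Ξ : Measure (Set.Ioi (0 : ℝ) × X)) [IsProbabilityMeasure Ξ] {w : X → ℝ≥0∞}
    (hw : Measurable w) (n j : ℕ) (s : ℝ) {t : ℝ} (ht : 0 ≤ t) :
    ∫⁻ ω, (dormantEvent n s ∩ dormantEvent (n + j) (s + t)).indicator (weightProd w (n + j)) ω
      ∂seqLaw α Ξ = dormantTerm α Ξ w n s * dormantTerm α Ξ w j t := by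
  have := seqLaw_isProbabilityMeasure hα Ξ
  have := isProbabilityMeasure_cycleLaw hα Ξ
  have hmeas : ∀ n (s : ℝ), Measurable
      ((dormantEvent n s ∩ dormantEvent (n + j) (s + t)).indicator (weightProd w (n + j))) :=
    fun n s => (measurable_weightProd hw _).indicator
      ((measurableSet_dormantEvent _ _).inter (measurableSet_dormantEvent _ _))
  induction n generalizing s with
  | zero =>
    rw [lintegral_seqLaw hα Ξ (hmeas 0 s)]
    by_cases hs : 0 ≤ s
    swap
    · simp [dormantTerm, Set.indicator, dormantEvent, hs]
    rw [dormantTerm, if_pos hs]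
    cases j with
    | zero =>
      have h := lintegral_cycleLaw_dormant hα Ξ (add_nonneg hs ht) (f := fun _ => 1)
        measurable_const
      rw [lintegral_one, measure_univ, mul_one] at h
      rw [dormantTerm, if_pos ht, ← ENNReal.ofReal_mul (Real.exp_pos _).le, ← Real.exp_add]
      rw [show -(α * s) + -(α * t) = -(α * (s + t)) by ring, ← h]
      refine lintegral_congr fun c => ?_
      have h1 : s + t < c.1 → s < c.1 := fun h => by linarith
      by_cases hc : s + t < c.1
      · simp [Set.indicator, dormantEvent, weightProd, add_nonneg, hs, ht, hc, h1 hc]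
      · simp [Set.indicator, dormantEvent, hc]
    | succ j =>
      rw [dormantTerm, ← lintegral_cycleLaw_dormant hα Ξ hs
        (f := fun c => w c.2.2 * dormantTerm α Ξ w j (t - cycleLength c))]
      swap
      · exact (by fun_prop : Measurable fun c : ℝ × (Set.Ioi (0 : ℝ) × X) => w c.2.2).mul
          ((measurable_dormantTerm hα Ξ hw j).comp (measurable_const.sub measurable_cycleLength))
      refine lintegral_congr fun c => ?_
      by_cases hc : s < c.1
      · rw [if_pos hc, ← lintegral_indicator_dormantEvent hα Ξ hw, ← lintegral_const_mul _
          ((measurable_weightProd hw _).indicator (measurableSet_dormantEvent _ _))]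
        refine lintegral_congr fun ω => ?_
        have h0 : consSeq c ω ∈ dormantEvent 0 s := by simp [dormantEvent, hs, hc]
        have h1 : s + t - cycleLength c = t - cycleLength (c.1 - s, c.2) := by
          simp only [cycleLength]; ring
        have h2 : 0 + (j + 1) = j + 1 := by omega
        refine indicator_eq_mul_indicator ?_ ?_
        · rw [Set.mem_inter_iff, h2, consSeq_mem_dormantEvent_succ, h1]
          exact and_iff_right h0
        · rw [h2, weightProd_consSeq_succ]
      · simp [dormantEvent, Set.indicator, hc]
  | succ n ih =>
    rw [lintegral_seqLaw hα Ξ (hmeas _ s), dormantTerm, ← lintegral_mul_const]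
    swap
    · exact (by fun_prop : Measurable fun c : ℝ × (Set.Ioi (0 : ℝ) × X) => w c.2.2).mul
          ((measurable_dormantTerm hα Ξ hw n).comp (measurable_const.sub measurable_cycleLength))
    refine lintegral_congr fun c => ?_
    rw [mul_assoc, ← ih, ← lintegral_const_mul _ (hmeas _ _)]
    refine lintegral_congr fun ω => ?_
    have h2 : n + 1 + j = n + j + 1 := by omega
    have h3 : s + t - cycleLength c = s - cycleLength c + t := by ring
    refine indicator_eq_mul_indicator ?_ ?_
    · simp only [Set.mem_inter_iff, h2, consSeq_mem_dormantEvent_succ, h3]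
    · rw [h2, weightProd_consSeq_succ]

end Sequences

/-! ### From point configurations to renewal quantities. -/

section Paths

variable {X : Type*} [MeasurableSpace X]

/-- The paths whose dormant periods are nonnegative and whose renewal points do not accumulate. -/
def regularPaths (X : Type*) : Set (ℕ → ℝ × (Set.Ioi (0 : ℝ) × X)) :=
  {ω | (∀ k, 0 ≤ (ω k).1) ∧ Tendsto (renewalPoint ω) atTop atTop}

lemma ae_cycleLaw_nonneg {α : ℝ} (hα : 0 < α) (Ξ : Measure (Set.Ioi (0 : ℝ) × X))
    [IsProbabilityMeasure Ξ] : ∀ᵐ c ∂cycleLaw α Ξ, 0 ≤ c.1 := by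
  have := ProbabilityTheory.isProbabilityMeasure_expMeasure hα
  exact Measure.quasiMeasurePreserving_fst.ae (ae_nonneg_expMeasure α)

lemma lintegral_exp_neg_renewalPoint {α : ℝ} (hα : 0 < α) (Ξ : Measure (Set.Ioi (0 : ℝ) × X))
    [IsProbabilityMeasure Ξ] (n : ℕ) :
    ∫⁻ ω, ENNReal.ofReal (Real.exp (-renewalPoint ω n)) ∂seqLaw α Ξ =
      (∫⁻ c, ENNReal.ofReal (Real.exp (-cycleLength c)) ∂cycleLaw α Ξ) ^ n := by
  have := seqLaw_isProbabilityMeasure hα Ξ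
  have hm : ∀ n, Measurable fun ω : ℕ → ℝ × (Set.Ioi (0 : ℝ) × X) =>
      ENNReal.ofReal (Real.exp (-renewalPoint ω n)) := fun n =>
    ((measurable_renewalPoint n).neg.exp).ennreal_ofReal
  have hc : Measurable fun c : ℝ × (Set.Ioi (0 : ℝ) × X) =>
      ENNReal.ofReal (Real.exp (-cycleLength c)) := measurable_cycleLength.neg.exp.ennreal_ofReal
  induction n with
  | zero => simp
  | succ n ih =>
    rw [lintegral_seqLaw hα Ξ (hm _), pow_succ', ← lintegral_mul_const _ hc]
    refine lintegral_congr fun c => ?_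
    rw [← ih, ← lintegral_const_mul _ (hm n)]
    refine lintegral_congr fun ω => ?_
    rw [renewalPoint_consSeq_succ, neg_add, Real.exp_add, ENNReal.ofReal_mul (Real.exp_pos _).le]

/-- The expectation of e^{-S_n} is r^n with r < 1, so ∑ e^{-S_n} is integrable and its terms tend to
0 almost surely. -/
lemma ae_regularPaths {α : ℝ} (hα : 0 < α) (Ξ : Measure (Set.Ioi (0 : ℝ) × X))
    [IsProbabilityMeasure Ξ] : ∀ᵐ ω ∂seqLaw α Ξ, ω ∈ regularPaths X := by
  have := isProbabilityMeasure_cycleLaw hα Ξ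
  have h1 : ∀ᵐ ω ∂seqLaw α Ξ, ∀ k, 0 ≤ (ω k).1 := ae_all_iff.2 fun k =>
    (measurePreserving_eval_infinitePi (fun _ : ℕ => cycleLaw α Ξ) k).quasiMeasurePreserving.ae
      (ae_cycleLaw_nonneg hα Ξ)
  have hr : ∫⁻ c, ENNReal.ofReal (Real.exp (-cycleLength c)) ∂cycleLaw α Ξ < 1 := by
    have hlt : ∀ᵐ c ∂cycleLaw α Ξ, ENNReal.ofReal (Real.exp (-cycleLength c)) < 1 := by
      filter_upwards [ae_cycleLaw_nonneg hα Ξ] with c hc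
      have h2 : (0 : ℝ) < c.2.1 := c.2.1.2
      rw [ENNReal.ofReal_lt_one, Real.exp_lt_one_iff, cycleLength]
      linarith
    have h3 : ∫⁻ c, ENNReal.ofReal (Real.exp (-cycleLength c)) ∂cycleLaw α Ξ ≤ 1 := by
      refine (lintegral_mono_ae (g := fun _ => 1) (hlt.mono fun c h => h.le)).trans ?_
      simp
    have h4 := lintegral_strict_mono (μ := cycleLaw α Ξ)
      (f := fun c => ENNReal.ofReal (Real.exp (-cycleLength c))) (g := fun _ => 1)
      (IsProbabilityMeasure.ne_zero _) aemeasurable_const (h3.trans_lt ENNReal.one_lt_top).ne hlt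
    simpa using h4
  have h2 : ∀ᵐ ω ∂seqLaw α Ξ, ∑' n, ENNReal.ofReal (Real.exp (-renewalPoint ω n)) < ∞ := by
    have hm : ∀ n, Measurable fun ω : ℕ → ℝ × (Set.Ioi (0 : ℝ) × X) =>
        ENNReal.ofReal (Real.exp (-renewalPoint ω n)) := fun n =>
      ((measurable_renewalPoint n).neg.exp).ennreal_ofReal
    refine ae_lt_top (Measurable.tsum hm) ?_
    rw [lintegral_tsum fun n => (hm n).aemeasurable]
    simp_rw [lintegral_exp_neg_renewalPoint hα Ξ]
    rw [ENNReal.tsum_geometric]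
    exact ENNReal.inv_ne_top.2 (tsub_pos_of_lt hr).ne'
  filter_upwards [h1, h2] with ω hω1 hω2
  refine ⟨hω1, ?_⟩
  have h3 := ENNReal.tendsto_atTop_zero_of_tsum_ne_top hω2.ne
  have h4 : Tendsto (fun n => Real.exp (-renewalPoint ω n)) atTop (𝓝 0) := by
    have h5 := (ENNReal.tendsto_toReal ENNReal.zero_ne_top).comp h3
    simpa [Function.comp_def, ENNReal.toReal_ofReal (Real.exp_pos _).le] using h5
  exact tendsto_neg_atBot_iff.1 (Real.tendsto_exp_comp_nhds_zero.1 h4)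

variable {ω : ℕ → ℝ × (Set.Ioi (0 : ℝ) × X)}

omit [MeasurableSpace X] in
lemma renewalPoint_add_le_succ (ω : ℕ → ℝ × (Set.Ioi (0 : ℝ) × X)) (n : ℕ) :
    renewalPoint ω n + (ω n).1 < renewalPoint ω (n + 1) := by
  have h : (0 : ℝ) < (ω n).2.1 := (ω n).2.1.2
  rw [renewalPoint_succ, cycleLength]
  linarith

omit [MeasurableSpace X] in
lemma monotone_renewalPoint (hω : ω ∈ regularPaths X) : Monotone (renewalPoint ω) :=
  monotone_nat_of_le_succ fun n => by
    have := hω.1 n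
    have := renewalPoint_add_le_succ ω n
    linarith

omit [MeasurableSpace X] in
lemma exists_renewalPoint_le_lt (hω : ω ∈ regularPaths X) {t : ℝ} (ht : 0 ≤ t) :
    ∃ n, renewalPoint ω n ≤ t ∧ t < renewalPoint ω (n + 1) := by
  have h : ∃ n, t < renewalPoint ω n := (hω.2.eventually_gt_atTop t).exists
  classical
  have h0 : Nat.find h ≠ 0 := fun h0 => by
    have := Nat.find_spec h
    rw [h0, renewalPoint_zero] at this
    linarith
  obtain ⟨n, hn⟩ := Nat.exists_eq_succ_of_ne_zero h0
  refine ⟨n, not_lt.1 (Nat.find_min h (by omega)), ?_⟩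
  have := Nat.find_spec h
  rwa [hn] at this

omit [MeasurableSpace X] in
lemma renewalIndex_unique (hω : ω ∈ regularPaths X) {t : ℝ} {n m : ℕ}
    (hn : renewalPoint ω n ≤ t) (hn' : t < renewalPoint ω (n + 1))
    (hm : renewalPoint ω m ≤ t) (hm' : t < renewalPoint ω (m + 1)) : n = m := by
  by_contra hne
  rcases lt_or_gt_of_ne hne with h | h
  · have := monotone_renewalPoint hω (show n + 1 ≤ m by omega)
    linarith
  · have := monotone_renewalPoint hω (show m + 1 ≤ n by omega)
    linarith

omit [MeasurableSpace X] in
lemma dormantEvent_unique (hω : ω ∈ regularPaths X) {t : ℝ} {n m : ℕ}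
    (hn : ω ∈ dormantEvent n t) (hm : ω ∈ dormantEvent m t) : n = m :=
  renewalIndex_unique hω hn.1 (hn.2.trans (renewalPoint_add_le_succ ω n)) hm.1
    (hm.2.trans (renewalPoint_add_le_succ ω m))

lemma measurableSet_active (t : ℝ) :
    MeasurableSet {p : Triangle × X | p.1.1.1 ≤ t ∧ t < p.1.1.2} := by
  have h1 : Measurable fun p : Triangle × X => p.1.1.1 := by fun_prop
  have h2 : Measurable fun p : Triangle × X => p.1.1.2 := by fun_prop
  exact (measurableSet_le h1 measurable_const).inter (measurableSet_lt measurable_const h2)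

lemma eta_mem_dormantAt (ω : ℕ → ℝ × (Set.Ioi (0 : ℝ) × X)) (t : ℝ) :
    eta ω ∈ dormantAt X t ↔
      ∀ n, ¬(renewalPoint ω n + (ω n).1 ≤ t ∧ t < renewalPoint ω (n + 1)) := by
  have h : eta ω ∈ dormantAt X t ↔ eta ω {p | p.1.1.1 ≤ t ∧ t < p.1.1.2} = 0 := Iff.rfl
  rw [h, eta, Measure.sum_apply _ (measurableSet_active t), ENNReal.tsum_eq_zero]
  refine forall_congr' fun n => ?_
  rw [Measure.dirac_apply' _ (measurableSet_active t), Set.indicator_apply_eq_zero]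
  simp [activeInterval]

lemma eta_mem_dormantAt_iff (hω : ω ∈ regularPaths X) {t : ℝ} (ht : 0 ≤ t) :
    eta ω ∈ dormantAt X t ↔ ∃ n, ω ∈ dormantEvent n t := by
  rw [eta_mem_dormantAt]
  constructor
  · intro h
    obtain ⟨n, hn, hn'⟩ := exists_renewalPoint_le_lt hω ht
    exact ⟨n, hn, not_le.1 fun h' => h n ⟨h', hn'⟩⟩
  · rintro ⟨n, hn⟩ m ⟨hm, hm'⟩
    have h1 := renewalPoint_add_le_succ ω n
    have h2 := hω.1 m
    have := renewalIndex_unique hω hn.1 (hn.2.trans h1) (by linarith) hm'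
    subst this
    linarith [hn.2]

omit [MeasurableSpace X] in
lemma meets_eq (a b : ℝ) :
    meets X a b = {p | max p.1.1.1 a ≤ min p.1.1.2 b} := by
  ext p
  simp only [meets, Set.mem_ofPred_eq, Set.Icc_inter_Icc, Set.nonempty_Icc]

lemma measurableSet_meets (a b : ℝ) : MeasurableSet (meets X a b) := by
  rw [meets_eq]
  exact measurableSet_le (by fun_prop) (by fun_prop)

lemma measurable_shiftPoint (t : ℝ) : Measurable (shiftPoint t : Triangle × X → Triangle × X) := by
  unfold shiftPoint
  refine Measurable.prodMk (Measurable.subtype_mk ?_) measurable_snd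
  fun_prop

lemma measurable_activeInterval (n : ℕ) :
    Measurable fun ω : ℕ → ℝ × (Set.Ioi (0 : ℝ) × X) => activeInterval ω n := by
  refine Measurable.subtype_mk (Measurable.prodMk ?_ (measurable_renewalPoint _))
  exact (measurable_renewalPoint n).add (measurable_pi_apply n).fst

lemma measurable_eta : Measurable (eta : (ℕ → ℝ × (Set.Ioi (0 : ℝ) × X)) → Config X) := by
  refine Measure.measurable_of_measurable_coe _ fun s hs => ?_
  have h : ∀ ω : ℕ → ℝ × (Set.Ioi (0 : ℝ) × X), eta ω s =
      ∑' n, s.indicator 1 (activeInterval ω n, (ω n).2.2) := fun ω => by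
    rw [eta, Measure.sum_apply _ hs]
    exact tsum_congr fun n => Measure.dirac_apply' _ hs
  simp_rw [h]
  refine Measurable.tsum fun n => (measurable_one.indicator hs).comp ?_
  exact (measurable_activeInterval n).prodMk (measurable_pi_apply n).snd.snd

/-- The configuration seen in the window `[-t, t]` around time `t`. -/
def windowConfig (t : ℝ) (ω : ℕ → ℝ × (Set.Ioi (0 : ℝ) × X)) : Config X :=
  restr (-t) t (shift t (eta ω))

lemma measurable_windowConfig (t : ℝ) :
    Measurable (windowConfig t : (ℕ → ℝ × (Set.Ioi (0 : ℝ) × X)) → Config X) := by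
  have h1 : Measurable (restr (-t) t : Config X → Config X) := by
    refine Measure.measurable_of_measurable_coe _ fun s hs => ?_
    simp_rw [restr, Measure.restrict_apply hs]
    exact Measure.measurable_coe (hs.inter (measurableSet_meets _ _))
  exact h1.comp ((Measure.measurable_map _ (measurable_shiftPoint t)).comp measurable_eta)

lemma measurableSet_dormantAt (t : ℝ) : MeasurableSet (dormantAt X t) :=
  Measure.measurable_coe (measurableSet_active t) (measurableSet_singleton 0)

lemma measurableSet_eta_dormant (t : ℝ) :
    MeasurableSet {ω : ℕ → ℝ × (Set.Ioi (0 : ℝ) × X) | eta ω ∈ dormantAt X t} :=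
  measurable_eta (measurableSet_dormantAt t)

lemma measurable_boltzmann {E : X → EReal} (hE : Measurable E) : Measurable (boltzmann E) := by
  have h : ∀ g : X → ℝ≥0∞, Measurable g →
      Measurable fun ζ : Config X => ((∫⁻ p, g p.2 ∂ζ : ℝ≥0∞) : EReal) := fun g hg =>
    (Measure.measurable_lintegral (hg.comp measurable_snd)).coe_ereal_ennreal
  refine Measurable.ereal_exp (Measurable.neg ?_)
  unfold hamiltonian
  simp_rw [sub_eq_add_neg]
  exact (h _ hE.ereal_toENNReal).add (h _ (Measurable.ereal_toENNReal hE.neg)).neg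

lemma lintegral_windowConfig {g : X → ℝ≥0∞} (hg : Measurable g) (t : ℝ)
    (ω : ℕ → ℝ × (Set.Ioi (0 : ℝ) × X)) :
    ∫⁻ p, g p.2 ∂windowConfig t ω = ∑' n, (meets X (-t) t).indicator (fun p => g p.2)
      (shiftPoint t (activeInterval ω n, (ω n).2.2)) := by
  have hm : Measurable ((meets X (-t) t).indicator fun p => g p.2) :=
    (hg.comp measurable_snd).indicator (measurableSet_meets _ _)
  rw [windowConfig, restr, ← lintegral_indicator (measurableSet_meets _ _), shift,
    lintegral_map hm (measurable_shiftPoint t), eta, lintegral_sum_measure]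
  exact tsum_congr fun n => lintegral_dirac' _ (hm.comp (measurable_shiftPoint t))

/-- The window is [0, 2t] before translation. Periods with index below N lie inside it; the later
ones start strictly after 2t because the N-th dormant period covers 2t. -/
lemma lintegral_windowConfig_of_dormant (hω : ω ∈ regularPaths X) {g : X → ℝ≥0∞}
    (hg : Measurable g) {t : ℝ} {N : ℕ} (hN : ω ∈ dormantEvent N (2 * t)) :
    ∫⁻ p, g p.2 ∂windowConfig t ω = ∑ k ∈ Finset.range N, g (ω k).2.2 := by
  have hmono := monotone_renewalPoint hω
  have ht : 0 ≤ 2 * t := by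
    have := hmono (Nat.zero_le N)
    rw [renewalPoint_zero] at this
    exact this.trans hN.1
  rw [lintegral_windowConfig hg, tsum_eq_sum (s := Finset.range N)]
  · refine Finset.sum_congr rfl fun k hk => Set.indicator_of_mem ?_ _
    have h1 := hmono (Nat.succ_le_of_lt (Finset.mem_range.1 hk))
    have h2 := hmono (Nat.zero_le k)
    have h3 := renewalPoint_add_le_succ ω k
    have h4 := hω.1 k
    have h5 := hN.1
    rw [renewalPoint_zero] at h2
    simp only [Nat.succ_eq_add_one] at h1
    simp only [meets_eq, Set.mem_ofPred_eq, shiftPoint, activeInterval, max_le_iff, le_min_iff]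
    refine ⟨⟨?_, ?_⟩, ?_, ?_⟩ <;> linarith
  · intro n hn
    refine Set.indicator_of_notMem ?_ _
    simp only [meets_eq, Set.mem_ofPred_eq, shiftPoint, activeInterval, max_le_iff, le_min_iff]
    intro h
    have h0 := h.1.2
    rw [Finset.mem_range, not_lt] at hn
    have h1 := hN.2
    rcases hn.eq_or_lt with h | h
    · subst h; linarith
    · have h2 := hmono (Nat.succ_le_of_lt h)
      have h3 := renewalPoint_add_le_succ ω N
      have h4 := hω.1 n
      simp only [Nat.succ_eq_add_one] at h2
      linarith

/-- The weight `e^{-E(x)}` of a state. -/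
def stateWeight (E : X → EReal) (x : X) : ℝ≥0∞ := EReal.exp (-E x)

lemma measurable_stateWeight {E : X → EReal} (hE : Measurable E) : Measurable (stateWeight E) :=
  hE.neg.ereal_exp

/-- At most one of the two parts of x is nonzero. This reassembles the Hamiltonian's separate
positive and negative integrals into a product over periods. -/
lemma exp_toENNReal_mul_exp_toENNReal_neg (x : EReal) :
    EReal.exp (-((x.toENNReal : ℝ≥0∞) : EReal)) * EReal.exp (((-x).toENNReal : ℝ≥0∞) : EReal) =
      EReal.exp (-x) := by
  rw [← EReal.exp_add]
  congr 1
  rcases le_total 0 x with h | h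
  · rw [EReal.coe_toENNReal h, EReal.toENNReal_of_nonpos (by simpa using h)]
    simp
  · have h' := EReal.neg_le_neg_iff.2 h
    rw [neg_zero] at h'
    rw [EReal.coe_toENNReal h', EReal.toENNReal_of_nonpos h]
    simp

lemma boltzmann_windowConfig (hω : ω ∈ regularPaths X) {E : X → EReal} (hE : Measurable E)
    (hE_top : ∀ x, E x ≠ ⊤) {t : ℝ} {N : ℕ} (hN : ω ∈ dormantEvent N (2 * t)) :
    boltzmann E (windowConfig t ω) = weightProd (stateWeight E) N ω := by
  rw [boltzmann, hamiltonian, lintegral_windowConfig_of_dormant hω hE.ereal_toENNReal hN,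
    lintegral_windowConfig_of_dormant hω (g := fun x => (-E x).toENNReal)
      (Measurable.ereal_toENNReal hE.neg) hN]
  -- E avoids ⊤ and only finitely many periods occur, so no ∞ - ∞ arises and the exponential of the
  -- difference splits.
  have hfin : ∑ k ∈ Finset.range N, (E (ω k).2.2).toENNReal ≠ ∞ := by
    refine ENNReal.sum_ne_top.2 fun k _ => ?_
    rw [Ne, EReal.toENNReal_eq_top_iff]
    exact hE_top _
  rw [EReal.neg_sub (Or.inl (EReal.coe_ennreal_ne_bot _))
    (Or.inl (by rwa [Ne, EReal.coe_ennreal_eq_top_iff])), EReal.exp_add]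
  clear hfin hN
  induction N with
  | zero => simp [weightProd]
  | succ N ih =>
    rw [weightProd, Finset.prod_range_succ, ← weightProd, ← ih, Finset.sum_range_succ,
      Finset.sum_range_succ, EReal.coe_ennreal_add, EReal.coe_ennreal_add, EReal.exp_add,
      EReal.neg_add (Or.inl (EReal.coe_ennreal_ne_bot _)) (Or.inr (EReal.coe_ennreal_ne_bot _)),
      sub_eq_add_neg, EReal.exp_add, stateWeight, ← exp_toENNReal_mul_exp_toENNReal_neg (E _)]
    ring

lemma zero_mem_dormantAt_windowConfig {t : ℝ} (ht : 0 ≤ t)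
    (ω : ℕ → ℝ × (Set.Ioi (0 : ℝ) × X)) :
    windowConfig t ω ∈ dormantAt X 0 ↔ eta ω ∈ dormantAt X t := by
  have h1 : windowConfig t ω ∈ dormantAt X 0 ↔
      windowConfig t ω {p | p.1.1.1 ≤ 0 ∧ 0 < p.1.1.2} = 0 := Iff.rfl
  have h2 : eta ω ∈ dormantAt X t ↔ eta ω {p | p.1.1.1 ≤ t ∧ t < p.1.1.2} = 0 := Iff.rfl
  rw [h1, h2, windowConfig, restr, Measure.restrict_apply (measurableSet_active 0),
    Set.inter_eq_left.2, shift, Measure.map_apply (measurable_shiftPoint t)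
      (measurableSet_active 0)]
  · have : shiftPoint t ⁻¹' {p : Triangle × X | p.1.1.1 ≤ 0 ∧ 0 < p.1.1.2} =
        {p | p.1.1.1 ≤ t ∧ t < p.1.1.2} := by
      ext p
      simp [shiftPoint]
    rw [this]
  · rintro p ⟨hp, hp'⟩
    exact ⟨0, ⟨hp, hp'.le⟩, by linarith, ht⟩

/-- On a regular path at most one n has t in its dormant period, so the restricted integral is a sum
over n. Leaving F free lets the same lemma serve for the constant 1 and for the Boltzmann weight. -/
lemma lintegral_dormant {α : ℝ} (hα : 0 < α) (Ξ : Measure (Set.Ioi (0 : ℝ) × X))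
    [IsProbabilityMeasure Ξ] {w : X → ℝ≥0∞} (hw : Measurable w)
    {F : (ℕ → ℝ × (Set.Ioi (0 : ℝ) × X)) → ℝ≥0∞} {t : ℝ} (ht : 0 ≤ t)
    (hF : ∀ ω ∈ regularPaths X, ∀ n, ω ∈ dormantEvent n t → F ω = weightProd w n ω) :
    ∫⁻ ω in {ω | eta ω ∈ dormantAt X t}, F ω ∂seqLaw α Ξ = dormantMass α Ξ w t := by
  rw [dormantMass, ← lintegral_indicator (measurableSet_eta_dormant t)]
  simp_rw [← lintegral_indicator_dormantEvent hα Ξ hw]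
  rw [← lintegral_tsum fun n => ((measurable_weightProd hw n).indicator
    (measurableSet_dormantEvent n t)).aemeasurable]
  refine lintegral_congr_ae ?_
  filter_upwards [ae_regularPaths hα Ξ] with ω hω
  by_cases h : ∃ n, ω ∈ dormantEvent n t
  · have h' : ω ∈ {ω | eta ω ∈ dormantAt X t} := (eta_mem_dormantAt_iff hω ht).2 h
    obtain ⟨n, hn⟩ := h
    rw [Set.indicator_of_mem h', tsum_eq_single n, Set.indicator_of_mem hn, hF ω hω n hn]
    exact fun m hm => Set.indicator_of_notMem (fun hm' => hm (dormantEvent_unique hω hm' hn)) _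
  · have h' : ω ∉ {ω | eta ω ∈ dormantAt X t} := fun h' =>
      h ((eta_mem_dormantAt_iff hω ht).1 h')
    rw [Set.indicator_of_notMem h']
    refine (ENNReal.tsum_eq_zero.2 fun n => ?_).symm
    exact Set.indicator_of_notMem (fun hn => h ⟨n, hn⟩) _

lemma lintegral_dormant_inter {α : ℝ} (hα : 0 < α) (Ξ : Measure (Set.Ioi (0 : ℝ) × X))
    [IsProbabilityMeasure Ξ] {w : X → ℝ≥0∞} (hw : Measurable w)
    {F : (ℕ → ℝ × (Set.Ioi (0 : ℝ) × X)) → ℝ≥0∞} {s t : ℝ} (hs : 0 ≤ s) (ht : 0 ≤ t)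
    (hF : ∀ ω ∈ regularPaths X, ∀ n, ω ∈ dormantEvent n (s + t) → F ω = weightProd w n ω) :
    ∫⁻ ω in {ω | eta ω ∈ dormantAt X s} ∩ {ω | eta ω ∈ dormantAt X (s + t)}, F ω ∂seqLaw α Ξ =
      dormantMass α Ξ w s * dormantMass α Ξ w t := by
  have hst := add_nonneg hs ht
  have hm : ∀ n j, Measurable ((dormantEvent n s ∩ dormantEvent (n + j) (s + t)).indicator
      (weightProd w (n + j))) := fun n j => (measurable_weightProd hw _).indicator
    ((measurableSet_dormantEvent _ _).inter (measurableSet_dormantEvent _ _))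
  rw [← lintegral_indicator ((measurableSet_eta_dormant s).inter (measurableSet_eta_dormant _)),
    dormantMass, dormantMass, ← ENNReal.tsum_mul_right]
  simp_rw [← ENNReal.tsum_mul_left, ← lintegral_indicator_dormantEvent_inter hα Ξ hw _ _ _ ht]
  simp_rw [← lintegral_tsum fun j => (hm _ j).aemeasurable]
  rw [← lintegral_tsum fun n => (Measurable.tsum fun j => hm n j).aemeasurable]
  refine lintegral_congr_ae ?_
  filter_upwards [ae_regularPaths hα Ξ] with ω hω
  by_cases h : eta ω ∈ dormantAt X s ∧ eta ω ∈ dormantAt X (s + t)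
  · obtain ⟨n, hn⟩ := (eta_mem_dormantAt_iff hω hs).1 h.1
    obtain ⟨m, hm⟩ := (eta_mem_dormantAt_iff hω hst).1 h.2
    have hnm : n ≤ m := by
      by_contra hlt
      have h1 := monotone_renewalPoint hω (show m + 1 ≤ n by omega)
      have h2 := renewalPoint_add_le_succ ω m
      linarith [hn.1, hm.2]
    obtain ⟨j, rfl⟩ := Nat.exists_eq_add_of_le hnm
    rw [Set.indicator_of_mem (show ω ∈ _ ∩ _ from h), tsum_eq_single n, tsum_eq_single j,
      Set.indicator_of_mem (show ω ∈ _ ∩ _ from ⟨hn, hm⟩), hF ω hω _ hm]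
    · intro i hi
      refine Set.indicator_of_notMem (fun hi' => hi ?_) _
      have := dormantEvent_unique hω hi'.2 hm
      omega
    · intro k hk
      refine ENNReal.tsum_eq_zero.2 fun i => Set.indicator_of_notMem (fun hi => hk ?_) _
      exact dormantEvent_unique hω hi.1 hn
  · rw [Set.indicator_of_notMem (show ω ∉ _ ∩ _ from h)]
    refine (ENNReal.tsum_eq_zero.2 fun n => ENNReal.tsum_eq_zero.2 fun j => ?_).symm
    refine Set.indicator_of_notMem (fun hn => h ⟨?_, ?_⟩) _
    · exact (eta_mem_dormantAt_iff hω hs).2 ⟨n, hn.1⟩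
    · exact (eta_mem_dormantAt_iff hω hst).2 ⟨_, hn.2⟩

/-- The probability of being dormant at `t`. -/
def dormantProb (α : ℝ) (Ξ : Measure (Set.Ioi (0 : ℝ) × X)) (t : ℝ) : ℝ≥0∞ :=
  dormantMass α Ξ (fun _ => 1) t

lemma seqLaw_dormantAt {α : ℝ} (hα : 0 < α) (Ξ : Measure (Set.Ioi (0 : ℝ) × X))
    [IsProbabilityMeasure Ξ] {t : ℝ} (ht : 0 ≤ t) :
    seqLaw α Ξ {ω | eta ω ∈ dormantAt X t} = dormantProb α Ξ t := by
  rw [dormantProb, ← lintegral_dormant hα Ξ measurable_const (F := fun _ => 1) ht]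
  · simp
  · intros; simp [weightProd]

lemma lintegral_gammaLaw {α : ℝ} (hα : 0 < α) (Ξ : Measure (Set.Ioi (0 : ℝ) × X))
    [IsProbabilityMeasure Ξ] {F : Config X → ℝ≥0∞} (hF : Measurable F) {t : ℝ} (ht : 0 ≤ t) :
    ∫⁻ ζ, F ζ ∂gammaLaw α Ξ t = (dormantProb α Ξ (2 * t))⁻¹ *
      ∫⁻ ω in {ω | eta ω ∈ dormantAt X (2 * t)}, F (windowConfig t ω) ∂seqLaw α Ξ := by
  have h : gammaLaw α Ξ t = (ProbabilityTheory.cond (seqLaw α Ξ)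
    {ω | eta ω ∈ dormantAt X (2 * t)}).map (windowConfig t) := rfl
  rw [h, lintegral_map hF (measurable_windowConfig t), ProbabilityTheory.cond,
    lintegral_smul_measure, seqLaw_dormantAt hα Ξ (by linarith), smul_eq_mul]

lemma partitionFn_eq {α : ℝ} (hα : 0 < α) (Ξ : Measure (Set.Ioi (0 : ℝ) × X))
    [IsProbabilityMeasure Ξ] {E : X → EReal} (hE : Measurable E) (hE_top : ∀ x, E x ≠ ⊤) {t : ℝ}
    (ht : 0 ≤ t) :
    partitionFn α Ξ E t = (dormantProb α Ξ t)⁻¹ * dormantMass α Ξ (stateWeight E) t := by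
  rw [partitionFn, lintegral_gammaLaw hα Ξ (measurable_boltzmann hE) (by linarith),
    lintegral_dormant hα Ξ (measurable_stateWeight hE) (by linarith)]
  · rw [mul_div_cancel₀ t two_ne_zero]
  · exact fun ω hω n hn => boltzmann_windowConfig hω hE hE_top hn

/-- Time 0 of the window is time t of the process, and dormancy at both t and 2t has weight A(t)² by
regeneration. -/
lemma gibbsLaw_dormantAt_zero {α : ℝ} (hα : 0 < α) (Ξ : Measure (Set.Ioi (0 : ℝ) × X))
    [IsProbabilityMeasure Ξ] {E : X → EReal} (hE : Measurable E) (hE_top : ∀ x, E x ≠ ⊤) {t : ℝ}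
    (ht : 0 ≤ t) :
    gibbsLaw α Ξ E t (dormantAt X 0) = (partitionFn α Ξ E (2 * t))⁻¹ *
      ((dormantProb α Ξ (2 * t))⁻¹ * dormantMass α Ξ (stateWeight E) t ^ 2) := by
  rw [gibbsLaw, Measure.smul_apply, smul_eq_mul, withDensity_apply _ (measurableSet_dormantAt 0),
    ← lintegral_indicator (measurableSet_dormantAt 0), lintegral_gammaLaw hα Ξ
      ((measurable_boltzmann hE).indicator (measurableSet_dormantAt 0)) ht, sq,
    ← lintegral_dormant_inter hα Ξ (measurable_stateWeight hE) ht ht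
      (F := fun ω => boltzmann E (windowConfig t ω)), ← two_mul,
    ← Measure.restrict_restrict (measurableSet_eta_dormant t),
    ← lintegral_indicator (measurableSet_eta_dormant t)]
  · congr 3
    funext ω
    by_cases h : eta ω ∈ dormantAt X t
    · rw [Set.indicator_of_mem ((zero_mem_dormantAt_windowConfig ht ω).2 h),
        Set.indicator_of_mem (show ω ∈ {ω | eta ω ∈ dormantAt X t} from h)]
    · rw [Set.indicator_of_notMem fun h' => h ((zero_mem_dormantAt_windowConfig ht ω).1 h'),
        Set.indicator_of_notMem (show ω ∉ {ω | eta ω ∈ dormantAt X t} from h)]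
  · rw [← two_mul]
    exact fun ω hω n hn => boltzmann_windowConfig hω hE hE_top hn

/-- The left side is the weight of the paths that are dormant at s + t and also at s. -/
lemma dormantMass_mul_le {α : ℝ} (hα : 0 < α) (Ξ : Measure (Set.Ioi (0 : ℝ) × X))
    [IsProbabilityMeasure Ξ] {E : X → EReal} (hE : Measurable E) (hE_top : ∀ x, E x ≠ ⊤)
    {s t : ℝ} (hs : 0 ≤ s) (ht : 0 ≤ t) :
    dormantMass α Ξ (stateWeight E) s * dormantMass α Ξ (stateWeight E) t ≤
      dormantMass α Ξ (stateWeight E) (s + t) := by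
  have hF : ∀ ω ∈ regularPaths X, ∀ n, ω ∈ dormantEvent n (s + t) →
      boltzmann E (windowConfig ((s + t) / 2) ω) = weightProd (stateWeight E) n ω := by
    intro ω hω n hn
    refine boltzmann_windowConfig hω hE hE_top ?_
    rwa [mul_div_cancel₀ _ two_ne_zero]
  rw [← lintegral_dormant_inter hα Ξ (measurable_stateWeight hE) hs ht hF,
    ← lintegral_dormant hα Ξ (measurable_stateWeight hE) (add_nonneg hs ht) hF]
  exact lintegral_mono_set Set.inter_subset_right

end Paths

/-! ### The renewal theorem for the dormancy probability. -/

section Renewal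

variable {X : Type*} [MeasurableSpace X]

lemma ae_pos_cycleLength {α : ℝ} (hα : 0 < α) (Ξ : Measure (Set.Ioi (0 : ℝ) × X))
    [IsProbabilityMeasure Ξ] : ∀ᵐ c ∂cycleLaw α Ξ, 0 < cycleLength c := by
  filter_upwards [ae_cycleLaw_nonneg hα Ξ] with c hc
  have h2 : (0 : ℝ) < c.2.1 := c.2.1.2
  rw [cycleLength]
  linarith

lemma dormantTerm_of_neg {α : ℝ} (hα : 0 < α) (Ξ : Measure (Set.Ioi (0 : ℝ) × X))
    [IsProbabilityMeasure Ξ] (w : X → ℝ≥0∞) (n : ℕ) {t : ℝ} (ht : t < 0) :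
    dormantTerm α Ξ w n t = 0 := by
  induction n generalizing t with
  | zero => simp [dormantTerm, ht]
  | succ n ih =>
    rw [dormantTerm, lintegral_congr_ae (g := fun _ => 0), lintegral_zero]
    filter_upwards [ae_pos_cycleLength hα Ξ] with c hc
    rw [ih (by linarith), mul_zero]

lemma dormantMass_of_neg {α : ℝ} (hα : 0 < α) (Ξ : Measure (Set.Ioi (0 : ℝ) × X))
    [IsProbabilityMeasure Ξ] (w : X → ℝ≥0∞) {t : ℝ} (ht : t < 0) :
    dormantMass α Ξ w t = 0 :=
  ENNReal.tsum_eq_zero.2 fun n => dormantTerm_of_neg hα Ξ w n ht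

/-- The renewal equation for the weight of dormant paths. -/
lemma dormantMass_eq_add {α : ℝ} (hα : 0 < α) (Ξ : Measure (Set.Ioi (0 : ℝ) × X))
    [IsProbabilityMeasure Ξ] {w : X → ℝ≥0∞} (hw : Measurable w) (t : ℝ) :
    dormantMass α Ξ w t = dormantTerm α Ξ w 0 t +
      ∫⁻ c, w c.2.2 * dormantMass α Ξ w (t - cycleLength c) ∂cycleLaw α Ξ := by
  have hm : ∀ n, Measurable fun c : ℝ × (Set.Ioi (0 : ℝ) × X) =>
      w c.2.2 * dormantTerm α Ξ w n (t - cycleLength c) := fun n =>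
    (by fun_prop : Measurable fun c : ℝ × (Set.Ioi (0 : ℝ) × X) => w c.2.2).mul
      ((measurable_dormantTerm hα Ξ hw n).comp (measurable_const.sub measurable_cycleLength))
  simp only [dormantMass, ← ENNReal.tsum_mul_left]
  rw [lintegral_tsum fun n => (hm n).aemeasurable, tsum_eq_zero_add' ENNReal.summable]
  rfl

lemma dormantProb_le_one {α : ℝ} (hα : 0 < α) (Ξ : Measure (Set.Ioi (0 : ℝ) × X))
    [IsProbabilityMeasure Ξ] (t : ℝ) : dormantProb α Ξ t ≤ 1 := by
  have := seqLaw_isProbabilityMeasure hα Ξ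
  rcases lt_or_ge t 0 with ht | ht
  · rw [dormantProb, dormantMass_of_neg hα Ξ _ ht]
    exact zero_le_one
  · rw [← seqLaw_dormantAt hα Ξ ht]
    exact prob_le_one

/-- The measure `α P(a > s) ds` on `[0, ∞)`. -/
def activeTail (α : ℝ) (Ξ : Measure (Set.Ioi (0 : ℝ) × X)) : Measure ℝ :=
  ENNReal.ofReal α •
    ((Ξ.prod volume).restrict {p | 0 ≤ p.2 ∧ p.2 < (p.1.1 : ℝ)}).map Prod.snd

lemma measurableSet_activeTail :
    MeasurableSet {p : (Set.Ioi (0 : ℝ) × X) × ℝ | 0 ≤ p.2 ∧ p.2 < (p.1.1 : ℝ)} :=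
  (measurableSet_le measurable_const measurable_snd).inter
    (measurableSet_lt measurable_snd measurable_fst.fst.subtype_val)

lemma lintegral_activeTail (α : ℝ) (Ξ : Measure (Set.Ioi (0 : ℝ) × X))
    [IsProbabilityMeasure Ξ] {f : ℝ → ℝ≥0∞} (hf : Measurable f) :
    ∫⁻ s, f s ∂activeTail α Ξ =
      ENNReal.ofReal α * ∫⁻ q, (∫⁻ s in Set.Ico 0 (q.1 : ℝ), f s) ∂Ξ := by
  rw [activeTail, lintegral_smul_measure, lintegral_map hf measurable_snd,
    ← lintegral_indicator measurableSet_activeTail, lintegral_prod (fun p =>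
      {p : (Set.Ioi (0 : ℝ) × X) × ℝ | 0 ≤ p.2 ∧ p.2 < (p.1.1 : ℝ)}.indicator (fun p => f p.2) p)
      ((hf.comp measurable_snd).indicator measurableSet_activeTail).aemeasurable, smul_eq_mul]
  congr 1
  refine lintegral_congr fun q => ?_
  rw [← lintegral_indicator measurableSet_Ico]
  rfl

lemma activeTail_univ (α : ℝ) (Ξ : Measure (Set.Ioi (0 : ℝ) × X))
    [IsProbabilityMeasure Ξ] :
    activeTail α Ξ Set.univ = ENNReal.ofReal α * ∫⁻ q, ENNReal.ofReal (q.1 : ℝ) ∂Ξ := by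
  rw [← lintegral_one, lintegral_activeTail α Ξ measurable_const]
  simp

lemma activeTail_absolutelyContinuous (α : ℝ) (Ξ : Measure (Set.Ioi (0 : ℝ) × X))
    [IsProbabilityMeasure Ξ] : activeTail α Ξ ≪ volume.restrict (Set.Ioi 0) := by
  refine Measure.AbsolutelyContinuous.mk fun s hs h => ?_
  rw [Measure.restrict_congr_set Ioi_ae_eq_Ici, Measure.restrict_apply hs] at h
  rw [← lintegral_indicator_one hs, lintegral_activeTail α Ξ (measurable_one.indicator hs)]
  have h' : ∀ q : Set.Ioi (0 : ℝ) × X,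
      ∫⁻ x in Set.Ico 0 (q.1 : ℝ), s.indicator 1 x = 0 := fun q => by
    rw [lintegral_indicator_one hs, Measure.restrict_apply hs]
    exact measure_mono_null (Set.inter_subset_inter_right _ Set.Ico_subset_Ici_self) h
  simp [h']

/-- The event that `t` lies in the active period that ends at the renewal point `n + 1`. -/
def activeEvent (n : ℕ) (t : ℝ) : Set (ℕ → ℝ × (Set.Ioi (0 : ℝ) × X)) :=
  {ω | renewalPoint ω n + (ω n).1 ≤ t ∧ t < renewalPoint ω (n + 1)}

lemma measurableSet_activeEvent (n : ℕ) (t : ℝ) :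
    MeasurableSet (activeEvent n t : Set (ℕ → ℝ × (Set.Ioi (0 : ℝ) × X))) :=
  (measurableSet_le ((measurable_renewalPoint n).add (measurable_pi_apply n).fst)
    measurable_const).inter (measurableSet_lt measurable_const (measurable_renewalPoint _))

omit [MeasurableSpace X] in
lemma consSeq_mem_activeEvent_succ (c : ℝ × (Set.Ioi (0 : ℝ) × X))
    (ω : ℕ → ℝ × (Set.Ioi (0 : ℝ) × X)) (n : ℕ) (t : ℝ) :
    consSeq c ω ∈ activeEvent (n + 1) t ↔ ω ∈ activeEvent n (t - cycleLength c) := by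
  simp only [activeEvent, Set.mem_ofPred_eq, renewalPoint_consSeq_succ, consSeq_succ]
  constructor <;> rintro ⟨h1, h2⟩ <;> constructor <;> linarith

instance sFinite_activeTail (α : ℝ) (Ξ : Measure (Set.Ioi (0 : ℝ) × X))
    [IsProbabilityMeasure Ξ] : SFinite (activeTail α Ξ) := by
  unfold activeTail
  infer_instance

/-- Activation occurs at rate α while dormant. If t is in an active period begun at t - s, the
process was dormant just before t - s and the period lasts longer than s. -/
lemma seqLaw_activeEvent {α : ℝ} (hα : 0 < α) (Ξ : Measure (Set.Ioi (0 : ℝ) × X))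
    [IsProbabilityMeasure Ξ] (n : ℕ) (t : ℝ) :
    ∫⁻ ω, (activeEvent n t).indicator 1 ω ∂seqLaw α Ξ =
      ∫⁻ s, dormantTerm α Ξ (fun _ => 1) n (t - s) ∂activeTail α Ξ := by
  have := seqLaw_isProbabilityMeasure hα Ξ
  have := isProbabilityMeasure_cycleLaw hα Ξ
  have := ProbabilityTheory.isProbabilityMeasure_expMeasure hα
  have hA := fun n => measurable_dormantTerm hα Ξ (w := fun _ => 1) measurable_const n
  induction n generalizing t with
  | zero =>
    have hA' : ∀ n, Measurable fun s => dormantTerm α Ξ (fun _ => 1) n (t - s) := fun n =>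
      (hA n).comp (measurable_const.sub measurable_id)
    have hm : MeasurableSet {c : ℝ × (Set.Ioi (0 : ℝ) × X) | c.1 ≤ t ∧ t < cycleLength c} :=
      (measurableSet_le measurable_fst measurable_const).inter
        (measurableSet_lt measurable_const measurable_cycleLength)
    have h1 : ∀ c : ℝ × (Set.Ioi (0 : ℝ) × X),
        ∫⁻ ω, (activeEvent 0 t).indicator 1 (consSeq c ω) ∂seqLaw α Ξ =
          {c : ℝ × (Set.Ioi (0 : ℝ) × X) | c.1 ≤ t ∧ t < cycleLength c}.indicator 1 c := by
      intro c
      have : ∀ ω, consSeq c ω ∈ activeEvent 0 t ↔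
          c ∈ {c : ℝ × (Set.Ioi (0 : ℝ) × X) | c.1 ≤ t ∧ t < cycleLength c} := fun ω => by
        simp [activeEvent, renewalPoint_consSeq_succ]
      by_cases h : c ∈ {c : ℝ × (Set.Ioi (0 : ℝ) × X) | c.1 ≤ t ∧ t < cycleLength c}
      · rw [Set.indicator_of_mem h]
        simp_rw [fun ω => Set.indicator_of_mem ((this ω).2 h)
          (1 : (ℕ → ℝ × (Set.Ioi (0 : ℝ) × X)) → ℝ≥0∞)]
        simp
      · rw [Set.indicator_of_notMem h]
        simp_rw [fun ω => Set.indicator_of_notMem (fun h' => h ((this ω).1 h'))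
          (1 : (ℕ → ℝ × (Set.Ioi (0 : ℝ) × X)) → ℝ≥0∞)]
        simp
    rw [lintegral_seqLaw hα Ξ (measurable_one.indicator (measurableSet_activeEvent 0 t)),
      lintegral_congr h1, cycleLaw, lintegral_prod_symm _
        (measurable_one.indicator hm).aemeasurable,
      lintegral_activeTail α Ξ (hA' 0),
      ← lintegral_const_mul']
    swap
    · exact ENNReal.ofReal_ne_top
    refine lintegral_congr fun q => ?_
    -- The reflection d ↦ t - d replaces the activation time by the age of the active period at t,
    -- turning the density αe^{-αd} into α times `dormantTerm` of index 0 at t minus the age.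
    rw [lintegral_expMeasure (f := fun d => {c : ℝ × (Set.Ioi (0 : ℝ) × X) |
        c.1 ≤ t ∧ t < cycleLength c}.indicator 1 (d, q))
      ((measurable_one.indicator hm).comp measurable_prodMk_right),
      ← lintegral_const_mul' _ _ ENNReal.ofReal_ne_top,
      ← lintegral_indicator measurableSet_Ici, ← lintegral_indicator measurableSet_Ico,
      ← lintegral_sub_left_eq_self _ t]
    refine lintegral_congr fun d => ?_
    simp only [Set.indicator, Set.mem_Ici, Set.mem_Ico, Set.mem_ofPred_eq, cycleLength,
      dormantTerm, Pi.one_apply]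
    by_cases h0 : 0 ≤ t - d
    · by_cases h3 : 0 ≤ d ∧ d < q.1
      · have h4 : t - d ≤ t ∧ t < t - d + q.1 := ⟨by linarith, by linarith⟩
        simp only [h0, h3, h4, if_true, and_self, mul_one]
        rw [ENNReal.ofReal_mul hα.le]
      · have h4 : ¬(t - d ≤ t ∧ t < t - d + q.1) := fun h => h3 ⟨by linarith, by linarith⟩
        simp only [h3, h4, if_false, mul_zero, ite_self]
    · simp [h0]
  | succ n ih =>
    rw [lintegral_seqLaw hα Ξ (measurable_one.indicator (measurableSet_activeEvent _ t))]
    have h1 : ∀ c : ℝ × (Set.Ioi (0 : ℝ) × X),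
        ∫⁻ ω, (activeEvent (n + 1) t).indicator 1 (consSeq c ω) ∂seqLaw α Ξ =
          ∫⁻ s, dormantTerm α Ξ (fun _ => 1) n (t - cycleLength c - s) ∂activeTail α Ξ := by
      intro c
      rw [← ih]
      refine lintegral_congr fun ω => ?_
      rw [indicator_eq_mul_indicator (r := 1) (g := 1) (consSeq_mem_activeEvent_succ c ω n t)
        (by simp), one_mul]
    rw [lintegral_congr h1, lintegral_lintegral_swap]
    · refine lintegral_congr fun s => ?_
      rw [dormantTerm]
      refine lintegral_congr fun c => ?_
      rw [one_mul, sub_right_comm]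
    · exact ((hA n).comp ((measurable_const.sub
        (measurable_cycleLength.comp measurable_fst)).sub measurable_snd)).aemeasurable

/-- At any time the process is either dormant or active. -/
lemma dormantProb_add_active {α : ℝ} (hα : 0 < α) (Ξ : Measure (Set.Ioi (0 : ℝ) × X))
    [IsProbabilityMeasure Ξ] {t : ℝ} (ht : 0 ≤ t) :
    dormantProb α Ξ t + ∫⁻ s, dormantProb α Ξ (t - s) ∂activeTail α Ξ = 1 := by
  have := seqLaw_isProbabilityMeasure hα Ξ
  have hA := fun n => measurable_dormantTerm hα Ξ (w := fun _ => 1) measurable_const n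
  have hA' : ∀ n, Measurable fun s => dormantTerm α Ξ (fun _ => 1) n (t - s) := fun n =>
    (hA n).comp (measurable_const.sub measurable_id)
  have hm1 : ∀ n, Measurable ((dormantEvent n t).indicator (weightProd (fun _ : X => 1) n)) :=
    fun n => (measurable_weightProd measurable_const n).indicator (measurableSet_dormantEvent n t)
  have hm2 : ∀ n, Measurable ((activeEvent n t).indicator
      (1 : (ℕ → ℝ × (Set.Ioi (0 : ℝ) × X)) → ℝ≥0∞)) :=
    fun n => measurable_one.indicator (measurableSet_activeEvent n t)
  simp only [dormantProb, dormantMass]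
  rw [lintegral_tsum fun n => (hA' n).aemeasurable,
    ← ENNReal.tsum_add]
  have hsum : ∀ n, dormantTerm α Ξ (fun _ => 1) n t +
      ∫⁻ s, dormantTerm α Ξ (fun _ => 1) n (t - s) ∂activeTail α Ξ =
      ∫⁻ ω, ((dormantEvent n t).indicator (weightProd (fun _ : X => 1) n) ω +
        (activeEvent n t).indicator 1 ω) ∂seqLaw α Ξ := fun n => by
    rw [lintegral_add_left (hm1 n), lintegral_indicator_dormantEvent hα Ξ measurable_const,
      seqLaw_activeEvent hα Ξ]
  simp_rw [hsum]
  have hm : ∀ n, Measurable fun ω : ℕ → ℝ × (Set.Ioi (0 : ℝ) × X) =>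
      (dormantEvent n t).indicator (weightProd (fun _ : X => 1) n) ω +
        (activeEvent n t).indicator 1 ω := fun n => (hm1 n).add (hm2 n)
  rw [← lintegral_tsum fun n => (hm n).aemeasurable, lintegral_congr_ae (g := fun _ => 1)]
  · simp
  filter_upwards [ae_regularPaths hα Ξ] with ω hω
  -- The dormant and active parts of a cycle partition it, and exactly one cycle contains t.
  have key : ∀ n, (dormantEvent n t).indicator (weightProd (fun _ : X => 1) n) ω +
      (activeEvent n t).indicator 1 ω =
        if renewalPoint ω n ≤ t ∧ t < renewalPoint ω (n + 1) then 1 else 0 := by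
    intro n
    have h1 := renewalPoint_add_le_succ ω n
    have h2 := hω.1 n
    by_cases hd : t < renewalPoint ω n + (ω n).1
    · have h3 : ω ∉ activeEvent n t := fun h => by linarith [h.1]
      by_cases hs : renewalPoint ω n ≤ t
      · have h4 : ω ∈ dormantEvent n t := ⟨hs, hd⟩
        rw [Set.indicator_of_mem h4, Set.indicator_of_notMem h3, if_pos ⟨hs, hd.trans h1⟩]
        simp [weightProd]
      · have h4 : ω ∉ dormantEvent n t := fun h => hs h.1
        rw [Set.indicator_of_notMem h4, Set.indicator_of_notMem h3, if_neg fun h => hs h.1,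
          add_zero]
    · have h3 : ω ∉ dormantEvent n t := fun h => hd h.2
      rw [not_lt] at hd
      by_cases hs : t < renewalPoint ω (n + 1)
      · have h4 : ω ∈ activeEvent n t := ⟨hd, hs⟩
        rw [Set.indicator_of_notMem h3, Set.indicator_of_mem h4, if_pos ⟨by linarith, hs⟩,
          zero_add, Pi.one_apply]
      · have h4 : ω ∉ activeEvent n t := fun h => hs h.2
        rw [Set.indicator_of_notMem h3, Set.indicator_of_notMem h4, if_neg fun h => hs h.2,
          add_zero]
  simp_rw [key]
  obtain ⟨n, hn⟩ := exists_renewalPoint_le_lt hω ht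
  rw [tsum_eq_single n, if_pos hn]
  exact fun m hm => if_neg fun h => hm (renewalIndex_unique hω h.1 h.2 hn.1 hn.2)

lemma ae_volume_of_ae_expMeasure {α : ℝ} (hα : 0 < α) {p : ℝ → Prop}
    (h : ∀ᵐ d ∂ProbabilityTheory.expMeasure α, p d) : ∀ᵐ d, 0 < d → p d := by
  have h' : ∀ᵐ d ∂volume.withDensity (ProbabilityTheory.exponentialPDF α), p d := h
  rw [ae_withDensity_iff] at h'
  · filter_upwards [h'] with d hd hd0
    refine hd ?_
    rw [ProbabilityTheory.exponentialPDF]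
    exact (ENNReal.ofReal_pos.2 (ProbabilityTheory.exponentialPDFReal_pos hα hd0)).ne'
  · exact (ProbabilityTheory.measurable_exponentialPDFReal α).ennreal_ofReal

/-- If the values of a bounded asymptotic solution of the renewal equation approach its upper limit
along a sequence, then so do, after a shift of the times, the values at almost all earlier times. -/
lemma exists_seq_tendsto_limsup {α : ℝ} (hα : 0 < α) (Ξ : Measure (Set.Ioi (0 : ℝ) × X))
    [IsProbabilityMeasure Ξ] {G : ℝ → ℝ} (hG : Measurable G) {B : ℝ} (hB : ∀ t, |G t| ≤ B)
    (h1 : Tendsto (fun t => G t - ∫ c, G (t - cycleLength c) ∂cycleLaw α Ξ) atTop (𝓝 0)) :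
    ∃ u : ℕ → ℝ, Tendsto u atTop atTop ∧ Tendsto (fun k => G (u k)) atTop (𝓝 (limsup G atTop)) ∧
      ∀ᵐ s : ℝ, 0 < s → Tendsto (fun k => G (u k - s)) atTop (𝓝 (limsup G atTop)) := by
  have := isProbabilityMeasure_cycleLaw hα Ξ
  have := ProbabilityTheory.isProbabilityMeasure_expMeasure hα
  set M := limsup G atTop with hM
  have hbdd : IsBoundedUnder (· ≤ ·) atTop G :=
    isBoundedUnder_of ⟨B, fun t => (abs_le.1 (hB t)).2⟩
  have hbdd' : IsBoundedUnder (· ≥ ·) atTop G :=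
    isBoundedUnder_of ⟨-B, fun t => (abs_le.1 (hB t)).1⟩
  have hcob : IsCoboundedUnder (· ≤ ·) atTop G := hbdd'.isCoboundedUnder_le
  have hup : ∀ ε > 0, ∀ᶠ t in atTop, G t < M + ε := fun ε hε =>
    eventually_lt_of_limsup_lt (by linarith) hbdd
  have hlow : ∀ n : ℕ, ∃ t : ℝ, (n : ℝ) ≤ t ∧ M - 1 / ((n : ℝ) + 1) < G t := fun n => by
    have h2 : ∃ᶠ t in atTop, M - 1 / ((n : ℝ) + 1) < G t :=
      frequently_lt_of_lt_limsup hcob (by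
        have : (0 : ℝ) < 1 / ((n : ℝ) + 1) := Nat.one_div_pos_of_nat
        linarith)
    obtain ⟨t, ht, ht'⟩ := (h2.and_eventually (eventually_ge_atTop (n : ℝ))).exists
    exact ⟨t, ht', ht⟩
  choose t ht hGt using hlow
  have ht_top : Tendsto t atTop atTop := tendsto_atTop_mono ht tendsto_natCast_atTop_atTop
  have hGlim : Tendsto (fun n => G (t n)) atTop (𝓝 M) := by
    rw [tendsto_order]
    constructor
    · intro a ha
      have h2 : Tendsto (fun n : ℕ => M - 1 / ((n : ℝ) + 1)) atTop (𝓝 (M - 0)) :=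
        tendsto_one_div_add_atTop_nhds_zero_nat.const_sub M
      rw [sub_zero] at h2
      filter_upwards [h2.eventually_const_lt ha] with n hn
      exact hn.trans (hGt n)
    · intro a ha
      filter_upwards [ht_top.eventually (hup (a - M) (by linarith))] with n hn
      linarith
  have hGm : ∀ n, Measurable fun c : ℝ × (Set.Ioi (0 : ℝ) × X) => G (t n - cycleLength c) :=
    fun n => hG.comp (measurable_const.sub measurable_cycleLength)
  have hint : ∀ n, Integrable (fun c => G (t n - cycleLength c)) (cycleLaw α Ξ) := fun n =>
    Integrable.of_bound (hGm n).aestronglyMeasurable B (ae_of_all _ fun c => by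
      rw [Real.norm_eq_abs]; exact hB _)
  -- By the asymptotic renewal equation, an average of earlier values also tends to M. Since values
  -- exceeding M are asymptotically negligible, this average can only be attained by convergence in
  -- L¹.
  have hI : Tendsto (fun n => ∫ c, (M - G (t n - cycleLength c)) ∂cycleLaw α Ξ) atTop (𝓝 0) := by
    have h2 := (tendsto_const_nhds (x := M)).sub (hGlim.sub (h1.comp ht_top))
    simp only [Function.comp_def, sub_sub_cancel, sub_zero, sub_self] at h2
    refine h2.congr fun n => ?_
    rw [integral_sub (integrable_const _) (hint n)]
    simp
  have hP : Tendsto (fun n => ∫ c, max (G (t n - cycleLength c) - M) 0 ∂cycleLaw α Ξ) atTop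
      (𝓝 0) := by
    have h2 : Tendsto (fun n => ∫ c, max (G (t n - cycleLength c) - M) 0 ∂cycleLaw α Ξ) atTop
        (𝓝 (∫ _, (0 : ℝ) ∂cycleLaw α Ξ)) := by
      refine tendsto_integral_of_dominated_convergence (fun _ => B + |M|)
        (fun n => (((hGm n).sub_const M).max measurable_const).aestronglyMeasurable)
        (integrable_const _) (fun n => ae_of_all _ fun c => ?_) (ae_of_all _ fun c => ?_)
      · rw [Real.norm_eq_abs, abs_of_nonneg (le_max_right _ _), max_le_iff]
        have h3 := (abs_le.1 (hB (t n - cycleLength c)))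
        have h4 := neg_abs_le M
        have h5 := abs_nonneg M
        constructor <;> linarith
      · have h3 : Tendsto (fun n => t n - cycleLength c) atTop atTop :=
          tendsto_atTop_add_const_right _ (-cycleLength c) ht_top
        rw [tendsto_order]
        constructor
        · intro a ha
          exact Eventually.of_forall fun n => ha.trans_le (le_max_right _ _)
        · intro a ha
          filter_upwards [h3.eventually (hup a ha)] with n hn
          exact max_lt (by linarith) ha
    simpa using h2
  -- Uses |x| = -x + 2 max(x, 0).
  have hN : Tendsto (fun n => ∫ c, |G (t n - cycleLength c) - M| ∂cycleLaw α Ξ) atTop (𝓝 0) := by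
    have h2 := hI.add (hP.const_mul 2)
    rw [mul_zero, add_zero] at h2
    refine h2.congr fun n => ?_
    have hi : Integrable (fun c => max (G (t n - cycleLength c) - M) 0) (cycleLaw α Ξ) :=
      ((hint n).sub (integrable_const M)).pos_part
    have hi' : Integrable (fun c => M - G (t n - cycleLength c)) (cycleLaw α Ξ) :=
      (integrable_const M).sub (hint n)
    rw [← integral_const_mul, ← integral_add hi' (hi.const_mul 2)]
    refine integral_congr_ae (ae_of_all _ fun c => ?_)
    dsimp only
    rcases le_total (G (t n - cycleLength c) - M) 0 with h | h
    · rw [max_eq_right h, abs_of_nonpos h]; ring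
    · rw [max_eq_left h, abs_of_nonneg h]; ring
  have hmeas : TendstoInMeasure (cycleLaw α Ξ) (fun n c => G (t n - cycleLength c)) atTop
      fun _ => M := by
    refine tendstoInMeasure_of_tendsto_eLpNorm one_ne_zero
      (fun n => (hGm n).aestronglyMeasurable) aestronglyMeasurable_const ?_
    have h2 : ∀ n, eLpNorm ((fun c => G (t n - cycleLength c)) - fun _ => M) 1 (cycleLaw α Ξ) =
        ENNReal.ofReal (∫ c, |G (t n - cycleLength c) - M| ∂cycleLaw α Ξ) := fun n => by
      rw [eLpNorm_one_eq_lintegral_enorm,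
        ← ofReal_integral_norm_eq_lintegral_enorm ((hint n).sub (integrable_const M))]
      rfl
    simp_rw [h2]
    simpa using ENNReal.tendsto_ofReal hN
  obtain ⟨ns, hns, hae⟩ := hmeas.exists_seq_tendsto_ae
  -- Swapping the factors allows one active period to be frozen, so that only the dormant length,
  -- which has a positive density on (0, ∞), varies.
  have hae2 : ∀ᵐ z ∂Ξ.prod (ProbabilityTheory.expMeasure α),
      Tendsto (fun k => G (t (ns k) - cycleLength (z.2, z.1))) atTop (𝓝 M) :=
    Measure.measurePreserving_swap.quasiMeasurePreserving.ae
      (p := fun c => Tendsto (fun k => G (t (ns k) - cycleLength c)) atTop (𝓝 M)) hae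
  obtain ⟨q, hq⟩ := (Measure.ae_ae_of_ae_prod hae2).exists
  have hq' := ae_volume_of_ae_expMeasure hα hq
  obtain ⟨b, hb0, hb⟩ : ∃ b : ℝ, 0 < b ∧
      Tendsto (fun k => G (t (ns k) - cycleLength (b, q))) atTop (𝓝 M) := by
    by_contra hcon
    have h2 : ∀ᵐ d : ℝ, d ∉ Set.Ioi (0 : ℝ) := by
      filter_upwards [hq'] with d hd hd0
      exact hcon ⟨d, hd0, hd hd0⟩
    have h3 : volume (Set.Ioi (0 : ℝ)) = 0 := measure_eq_zero_iff_ae_notMem.2 h2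
    simp at h3
  -- Take u_k = t_{n_k} - b - a, with a the frozen active length. The lag s then corresponds to a
  -- dormant length b + s, so the convergence holds at s = 0 and at almost every s > 0.
  refine ⟨fun k => t (ns k) - cycleLength (b, q), ?_, hb, ?_⟩
  · exact tendsto_atTop_add_const_right _ (-cycleLength (b, q))
      (ht_top.comp hns.tendsto_atTop)
  · have h2 := (measurePreserving_add_left volume b).quasiMeasurePreserving.ae hq'
    filter_upwards [h2] with s hs hs0
    refine (hs (by linarith)).congr fun k => ?_
    simp only [cycleLength]
    ring_nf

/-- Evaluate the second relation along the times u_k. Absolute continuity of κ turns almost every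
lag into κ-almost every lag, so by dominated convergence every value of G may be replaced by its
upper limit. -/
lemma limsup_mul_eq_of_renewal {α : ℝ} (hα : 0 < α) (Ξ : Measure (Set.Ioi (0 : ℝ) × X))
    [IsProbabilityMeasure Ξ] {κ : Measure ℝ} [IsFiniteMeasure κ]
    (hκ : κ ≪ volume.restrict (Set.Ioi 0)) {G : ℝ → ℝ} (hG : Measurable G) {B : ℝ}
    (hB : ∀ t, |G t| ≤ B)
    (h1 : Tendsto (fun t => G t - ∫ c, G (t - cycleLength c) ∂cycleLaw α Ξ) atTop (𝓝 0))
    {c : ℝ} (h2 : Tendsto (fun t => G t + ∫ s, G (t - s) ∂κ) atTop (𝓝 c)) :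
    limsup G atTop * (1 + κ.real Set.univ) = c := by
  obtain ⟨u, hu, hGu, hae⟩ := exists_seq_tendsto_limsup hα Ξ hG hB h1
  have h3 : ∀ᵐ s ∂κ, Tendsto (fun k => G (u k - s)) atTop (𝓝 (limsup G atTop)) :=
    hκ.ae_le ((ae_restrict_iff' measurableSet_Ioi).2 hae)
  have h4 : Tendsto (fun k => ∫ s, G (u k - s) ∂κ) atTop (𝓝 (∫ _, limsup G atTop ∂κ)) :=
    tendsto_integral_of_dominated_convergence (fun _ => B)
      (fun n => (hG.comp (measurable_const.sub measurable_id)).aestronglyMeasurable)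
      (integrable_const _) (fun n => ae_of_all _ fun s => by
        rw [Real.norm_eq_abs]; exact hB _) h3
  have h5 := tendsto_nhds_unique (hGu.add h4) (h2.comp hu)
  rw [← h5, integral_const, smul_eq_mul]
  ring

lemma toReal_lintegral_comp_sub {β : Type*} [MeasurableSpace β] {μ : Measure β}
    {f : ℝ → ℝ≥0∞} (hf : Measurable f) (hf1 : ∀ t, f t ≤ 1) {g : β → ℝ} (hg : Measurable g)
    (t : ℝ) : (∫⁻ c, f (t - g c) ∂μ).toReal = ∫ c, (f (t - g c)).toReal ∂μ :=
  (integral_toReal (hf.comp (measurable_const.sub hg)).aemeasurable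
    (ae_of_all _ fun _ => (hf1 _).trans_lt ENNReal.one_lt_top)).symm

/-- The renewal theorem for the alternating process. -/
theorem tendsto_dormantProb {α : ℝ} (hα : 0 < α) (Ξ : Measure (Set.Ioi (0 : ℝ) × X))
    [IsProbabilityMeasure Ξ] (hΞ : ∫⁻ q, ENNReal.ofReal (q.1 : ℝ) ∂Ξ < ∞) :
    Tendsto (fun t => (dormantProb α Ξ t).toReal) atTop
      (𝓝 (1 + α * (∫⁻ q, ENNReal.ofReal (q.1 : ℝ) ∂Ξ).toReal)⁻¹) := by
  have := isProbabilityMeasure_cycleLaw hα Ξ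
  set κ := activeTail α Ξ with hκ
  have hκu : κ.real Set.univ = α * (∫⁻ q, ENNReal.ofReal (q.1 : ℝ) ∂Ξ).toReal := by
    rw [hκ, measureReal_def, activeTail_univ, ENNReal.toReal_mul, ENNReal.toReal_ofReal hα.le]
  have : IsFiniteMeasure κ :=
    ⟨by rw [hκ, activeTail_univ]; exact ENNReal.mul_lt_top ENNReal.ofReal_lt_top hΞ⟩
  rw [← hκu]
  set G : ℝ → ℝ := fun t => (dormantProb α Ξ t).toReal with hGdef
  have hDm : Measurable (dormantProb α Ξ) := measurable_dormantMass hα Ξ measurable_const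
  have hD1 := dormantProb_le_one hα Ξ
  have hGm : Measurable G := hDm.ennreal_toReal
  have hG0 : ∀ t, 0 ≤ G t := fun t => ENNReal.toReal_nonneg
  have hG1 : ∀ t, G t ≤ 1 := fun t => ENNReal.toReal_mono ENNReal.one_ne_top (hD1 t)
  have hGabs : ∀ t, |G t| ≤ 1 := fun t => by rw [abs_of_nonneg (hG0 t)]; exact hG1 t
  have h1 : Tendsto (fun t => G t - ∫ c, G (t - cycleLength c) ∂cycleLaw α Ξ) atTop (𝓝 0) := by
    have h3 : Tendsto (fun t => Real.exp (-(α * t))) atTop (𝓝 0) :=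
      Real.tendsto_exp_atBot.comp (tendsto_neg_atTop_atBot.comp
        (tendsto_id.const_mul_atTop hα))
    refine h3.congr' ?_
    filter_upwards [eventually_ge_atTop 0] with t ht
    have h4 := dormantMass_eq_add hα Ξ (w := fun _ => 1) measurable_const t
    simp only [one_mul, dormantTerm, if_pos ht] at h4
    have h5 : ∫⁻ c, dormantMass α Ξ (fun _ => 1) (t - cycleLength c) ∂cycleLaw α Ξ ≠ ∞ := by
      refine ne_top_of_le_ne_top ENNReal.one_ne_top ((lintegral_mono fun c => hD1 _).trans ?_)
      simp
    have h6 := congrArg ENNReal.toReal h4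
    rw [ENNReal.toReal_add ENNReal.ofReal_ne_top h5, ENNReal.toReal_ofReal (Real.exp_pos _).le,
      toReal_lintegral_comp_sub (f := dormantMass α Ξ fun _ => 1) hDm hD1
        measurable_cycleLength] at h6
    rw [eq_sub_iff_add_eq]
    exact h6.symm
  have h2 : Tendsto (fun t => G t + ∫ s, G (t - s) ∂κ) atTop (𝓝 1) := by
    refine tendsto_const_nhds.congr' ?_
    filter_upwards [eventually_ge_atTop 0] with t ht
    have h4 := dormantProb_add_active hα Ξ ht
    have h5 : ∫⁻ s, dormantProb α Ξ (t - s) ∂κ ≠ ∞ := fun h => by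
      rw [h, add_top] at h4
      exact ENNReal.top_ne_one h4
    have h6 := congrArg ENNReal.toReal h4
    rw [ENNReal.toReal_add (ne_top_of_le_ne_top ENNReal.one_ne_top (hD1 t)) h5,
      toReal_lintegral_comp_sub hDm hD1 measurable_id', ENNReal.toReal_one] at h6
    exact h6.symm
  have hac := activeTail_absolutelyContinuous α Ξ
  have hL := limsup_mul_eq_of_renewal hα Ξ hac hGm hGabs h1 h2
  -- Negating G yields the lower limit: both hypotheses are linear, and the constant becomes -1.
  have hL' := limsup_mul_eq_of_renewal hα Ξ hac (G := fun t => -G t) hGm.neg (B := 1)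
    (fun t => by rw [abs_neg]; exact hGabs t) (by
      have := h1.neg
      simp only [neg_zero] at this
      refine this.congr fun t => ?_
      rw [integral_neg]; ring) (by
      have := h2.neg
      refine this.congr fun t => ?_
      rw [integral_neg]; ring)
  have hpos : 0 < 1 + κ.real Set.univ := by positivity
  rw [← eq_div_iff hpos.ne'] at hL hL'
  have hb1 : IsBoundedUnder (· ≤ ·) atTop G := isBoundedUnder_of ⟨1, hG1⟩
  have hb2 : IsBoundedUnder (· ≤ ·) atTop fun t => -G t :=
    isBoundedUnder_of ⟨0, fun t => neg_nonpos.2 (hG0 t)⟩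
  rw [tendsto_order]
  constructor
  · intro a ha
    have h3 : limsup (fun t => -G t) atTop < -a := by
      rw [hL', neg_div, one_div]; linarith
    filter_upwards [eventually_lt_of_limsup_lt h3 hb2] with t ht
    linarith
  · intro a ha
    exact eventually_lt_of_limsup_lt (by rw [hL, one_div]; exact ha) hb1

end Renewal

/-! ### Exponential tilting, sharp asymptotics and the Laplace transform. -/

section Tilting

variable {X : Type*} [MeasurableSpace X]

omit [MeasurableSpace X] in
lemma tiltWeight_eq (E : X → EReal) (lam : ℝ) (c : ℝ × (Set.Ioi (0 : ℝ) × X)) :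
    tiltWeight E lam c =
      ENNReal.ofReal (Real.exp (-(lam * cycleLength c))) * stateWeight E c.2.2 := by
  rw [tiltWeight, sub_eq_add_neg, EReal.exp_add, EReal.exp_coe, neg_mul]
  rfl

omit [MeasurableSpace X] in
lemma tiltWeight_eq_mul (E : X → EReal) (lam : ℝ) (c : ℝ × (Set.Ioi (0 : ℝ) × X)) :
    tiltWeight E lam c = ENNReal.ofReal (Real.exp (-(lam * c.1))) *
      EReal.exp (((-lam * (c.2.1 : ℝ) : ℝ) : EReal) - E c.2.2) := by
  rw [tiltWeight_eq, cycleLength, mul_add, neg_add, Real.exp_add,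
    ENNReal.ofReal_mul (Real.exp_pos _).le, sub_eq_add_neg, EReal.exp_add, EReal.exp_coe, neg_mul,
    mul_assoc]
  rfl

lemma measurable_stateTilt {E : X → EReal} (hE : Measurable E) (lam : ℝ) :
    Measurable fun q : Set.Ioi (0 : ℝ) × X =>
      EReal.exp (((-lam * (q.1 : ℝ) : ℝ) : EReal) - E q.2) := by
  simp_rw [sub_eq_add_neg]
  have h : Measurable fun q : Set.Ioi (0 : ℝ) × X => ((-lam * (q.1 : ℝ) : ℝ) : EReal) :=
    (measurable_fst.subtype_val.const_mul (-lam)).coe_real_ereal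
  exact (h.add (hE.comp measurable_snd).neg).ereal_exp

lemma measurable_tiltWeight {E : X → EReal} (hE : Measurable E) (lam : ℝ) :
    Measurable (tiltWeight E lam) := by
  have h : tiltWeight E lam = _ := funext fun c => tiltWeight_eq E lam c
  rw [h]
  exact ((measurable_cycleLength.const_mul lam).neg.exp.ennreal_ofReal).mul
    ((measurable_stateWeight hE).comp measurable_snd.snd)

lemma lintegral_exp_neg_Ici {b : ℝ} (hb : 0 < b) :
    ∫⁻ d in Set.Ici (0 : ℝ), ENNReal.ofReal (Real.exp (-(b * d))) = ENNReal.ofReal (1 / b) := by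
  have := ProbabilityTheory.isProbabilityMeasure_expMeasure hb
  have h := lintegral_expMeasure (α := b) (f := fun _ => 1) measurable_const
  rw [lintegral_one, measure_univ] at h
  simp_rw [mul_one, ENNReal.ofReal_mul hb.le] at h
  rw [lintegral_const_mul' _ _ ENNReal.ofReal_ne_top] at h
  rw [one_div, ENNReal.ofReal_inv_of_pos hb]
  exact ENNReal.eq_inv_of_mul_eq_one_left (by rw [mul_comm]; exact h.symm)

lemma lintegral_expMeasure_exp {α lam : ℝ} (hα : 0 < α) (h : 0 < α + lam) :
    ∫⁻ d, ENNReal.ofReal (Real.exp (-(lam * d))) ∂ProbabilityTheory.expMeasure α =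
      ENNReal.ofReal (α / (α + lam)) := by
  rw [lintegral_expMeasure (by fun_prop), div_eq_mul_one_div, ENNReal.ofReal_mul hα.le,
    ← lintegral_exp_neg_Ici h, ← lintegral_const_mul' _ _ ENNReal.ofReal_ne_top]
  refine lintegral_congr fun d => ?_
  rw [← ENNReal.ofReal_mul (by positivity), ← ENNReal.ofReal_mul hα.le, mul_assoc, ← Real.exp_add]
  ring_nf

lemma lintegral_expMeasure_exp_eq_top {α lam : ℝ} (hα : 0 < α) (h : α + lam ≤ 0) :
    ∫⁻ d, ENNReal.ofReal (Real.exp (-(lam * d))) ∂ProbabilityTheory.expMeasure α = ∞ := by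
  rw [lintegral_expMeasure (by fun_prop), eq_top_iff]
  calc ∞ = ∫⁻ _ in Set.Ici (0 : ℝ), ENNReal.ofReal α := by
        rw [setLIntegral_const, Real.volume_Ici, ENNReal.mul_top]
        exact (ENNReal.ofReal_pos.2 hα).ne'
    _ ≤ _ := by
        refine setLIntegral_mono' measurableSet_Ici fun d hd => ?_
        rw [← ENNReal.ofReal_mul (by positivity), mul_assoc, ← Real.exp_add]
        refine ENNReal.ofReal_le_ofReal (le_mul_of_one_le_right hα.le (Real.one_le_exp ?_))
        have : (α + lam) * d ≤ 0 := mul_nonpos_of_nonpos_of_nonneg h hd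
        linarith

lemma lintegral_tiltWeight {α : ℝ} (hα : 0 < α) (Ξ : Measure (Set.Ioi (0 : ℝ) × X))
    [IsProbabilityMeasure Ξ] {E : X → EReal} (hE : Measurable E) (lam : ℝ) :
    ∫⁻ c, tiltWeight E lam c ∂cycleLaw α Ξ =
      (∫⁻ d, ENNReal.ofReal (Real.exp (-(lam * d))) ∂ProbabilityTheory.expMeasure α) *
        ∫⁻ q, EReal.exp (((-lam * (q.1 : ℝ) : ℝ) : EReal) - E q.2) ∂Ξ := by
  have := ProbabilityTheory.isProbabilityMeasure_expMeasure hα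
  simp_rw [tiltWeight_eq_mul]
  rw [cycleLaw]
  exact lintegral_prod_mul (f := fun d : ℝ => ENNReal.ofReal (Real.exp (-(lam * d))))
    (by fun_prop) (measurable_stateTilt hE lam).aemeasurable

/-- The cycle integral factors. If α + lam ≤ 0 its dormant factor is infinite, while its active
factor is nonzero because E never equals ⊤. -/
lemma pos_of_lintegral_tiltWeight_ne_top {α : ℝ} (hα : 0 < α)
    (Ξ : Measure (Set.Ioi (0 : ℝ) × X)) [IsProbabilityMeasure Ξ] {E : X → EReal}
    (hE : Measurable E) (hE_top : ∀ x, E x ≠ ⊤) {lam : ℝ}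
    (h : ∫⁻ c, tiltWeight E lam c ∂cycleLaw α Ξ ≠ ∞) : 0 < α + lam := by
  by_contra hneg
  rw [lintegral_tiltWeight hα Ξ hE, lintegral_expMeasure_exp_eq_top hα (not_lt.1 hneg)] at h
  refine h (ENNReal.top_mul fun h0 => ?_)
  rw [lintegral_eq_zero_iff (measurable_stateTilt hE lam)] at h0
  obtain ⟨q, hq⟩ := h0.exists
  simp only [Pi.zero_apply, EReal.exp_eq_zero_iff, sub_eq_add_neg, EReal.add_eq_bot_iff,
    EReal.coe_ne_bot, EReal.neg_eq_bot_iff, false_or] at hq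
  exact hE_top _ hq

lemma tiltedLaw_univ {α : ℝ} (hα : 0 < α) (Ξ : Measure (Set.Ioi (0 : ℝ) × X))
    [IsProbabilityMeasure Ξ] {E : X → EReal} (hE : Measurable E) {lam : ℝ} (h : 0 < α + lam) :
    tiltedLaw α Ξ E lam Set.univ = ∫⁻ c, tiltWeight E lam c ∂cycleLaw α Ξ := by
  rw [lintegral_tiltWeight hα Ξ hE, lintegral_expMeasure_exp hα h, tiltedLaw, Measure.smul_apply,
    withDensity_apply _ MeasurableSet.univ, Measure.restrict_univ, smul_eq_mul]

lemma expMeasure_add {α lam : ℝ} (hα : 0 < α) (h : 0 < α + lam) :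
    ProbabilityTheory.expMeasure (α + lam) = ENNReal.ofReal ((α + lam) / α) •
      (ProbabilityTheory.expMeasure α).withDensity
        fun d => ENNReal.ofReal (Real.exp (-(lam * d))) := by
  refine Measure.ext_of_lintegral _ fun f hf => ?_
  have hm : Measurable fun d : ℝ => ENNReal.ofReal (Real.exp (-(lam * d))) := by fun_prop
  rw [lintegral_smul_measure, lintegral_withDensity_eq_lintegral_mul _ hm hf,
    lintegral_expMeasure (hm.mul hf), lintegral_expMeasure hf, smul_eq_mul,
    ← lintegral_const_mul' _ _ ENNReal.ofReal_ne_top]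
  refine lintegral_congr fun d => ?_
  rw [Pi.mul_apply, ← mul_assoc, ← mul_assoc, ← ENNReal.ofReal_mul (by positivity),
    ← ENNReal.ofReal_mul (by positivity)]
  congr 2
  rw [show -((α + lam) * d) = -(α * d) + -(lam * d) by ring, Real.exp_add]
  field_simp

/-- Tilting Exp(α) by e^{-lam d} gives Exp(α + lam) up to the factor α/(α + lam). That factor is
placed in `tiltedLaw`, so the two normalisations cancel. -/
lemma cycleLaw_tiltedLaw {α : ℝ} (hα : 0 < α) (Ξ : Measure (Set.Ioi (0 : ℝ) × X))
    [IsProbabilityMeasure Ξ] {E : X → EReal} (hE : Measurable E) {lam : ℝ} (h : 0 < α + lam) :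
    cycleLaw (α + lam) (tiltedLaw α Ξ E lam) =
      (cycleLaw α Ξ).withDensity (tiltWeight E lam) := by
  have := ProbabilityTheory.isProbabilityMeasure_expMeasure hα
  rw [cycleLaw, expMeasure_add hα h, tiltedLaw, Measure.prod_smul_left, Measure.prod_smul_right,
    prod_withDensity (by fun_prop) (measurable_stateTilt hE lam), smul_smul,
    ← ENNReal.ofReal_mul (by positivity), show (α + lam) / α * (α / (α + lam)) = 1 by field_simp,
    ENNReal.ofReal_one, one_smul]
  congr 1
  funext c
  rw [tiltWeight_eq_mul]

/-- The factor e^{-lam t} splits as e^{-lam T}e^{-lam (t-T)} over the first cycle T. The last,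
incomplete dormant period supplies e^{-(α+lam)r} = e^{-lam r}e^{-αr}. -/
lemma dormantTerm_tiltedLaw {α : ℝ} (hα : 0 < α) (Ξ : Measure (Set.Ioi (0 : ℝ) × X))
    [IsProbabilityMeasure Ξ] {E : X → EReal} (hE : Measurable E) {lam : ℝ} (h : 0 < α + lam)
    [IsProbabilityMeasure (tiltedLaw α Ξ E lam)] (n : ℕ) (t : ℝ) :
    dormantTerm (α + lam) (tiltedLaw α Ξ E lam) (fun _ => 1) n t =
      ENNReal.ofReal (Real.exp (-(lam * t))) * dormantTerm α Ξ (stateWeight E) n t := by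
  induction n generalizing t with
  | zero =>
    simp only [dormantTerm]
    split_ifs
    · rw [← ENNReal.ofReal_mul (Real.exp_pos _).le, ← Real.exp_add]
      ring_nf
    · rw [mul_zero]
  | succ n ih =>
    rw [dormantTerm, dormantTerm, cycleLaw_tiltedLaw hα Ξ hE h,
      lintegral_withDensity_eq_lintegral_mul _ (measurable_tiltWeight hE lam),
      ← lintegral_const_mul' _ _ ENNReal.ofReal_ne_top]
    · refine lintegral_congr fun c => ?_
      rw [Pi.mul_apply, one_mul, ih, tiltWeight_eq]
      rw [show -(lam * t) = -(lam * cycleLength c) + -(lam * (t - cycleLength c)) by ring,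
        Real.exp_add, ENNReal.ofReal_mul (Real.exp_pos _).le]
      ring
    · exact ((measurable_dormantTerm h (tiltedLaw α Ξ E lam) measurable_const n).comp
        (measurable_const.sub measurable_cycleLength)).const_mul 1

lemma dormantProb_tiltedLaw {α : ℝ} (hα : 0 < α) (Ξ : Measure (Set.Ioi (0 : ℝ) × X))
    [IsProbabilityMeasure Ξ] {E : X → EReal} (hE : Measurable E) {lam : ℝ} (h : 0 < α + lam)
    [IsProbabilityMeasure (tiltedLaw α Ξ E lam)] (t : ℝ) :
    dormantProb (α + lam) (tiltedLaw α Ξ E lam) t =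
      ENNReal.ofReal (Real.exp (-(lam * t))) * dormantMass α Ξ (stateWeight E) t := by
  rw [dormantProb, dormantMass, dormantMass, ← ENNReal.tsum_mul_left]
  exact tsum_congr fun n => dormantTerm_tiltedLaw hα Ξ hE h n t

lemma meanCycle_tiltedLaw {α : ℝ} (hα : 0 < α) (Ξ : Measure (Set.Ioi (0 : ℝ) × X))
    [IsProbabilityMeasure Ξ] {E : X → EReal} (hE : Measurable E) {lam : ℝ} (h : 0 < α + lam) :
    meanCycle (α + lam) (tiltedLaw α Ξ E lam) =
      ∫⁻ c, ENNReal.ofReal (cycleLength c) * tiltWeight E lam c ∂cycleLaw α Ξ := by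
  rw [meanCycle, cycleLaw_tiltedLaw hα Ξ hE h, lintegral_withDensity_eq_lintegral_mul _
    (measurable_tiltWeight hE lam) measurable_cycleLength.ennreal_ofReal]
  exact lintegral_congr fun c => mul_comm _ _

lemma lintegral_expMeasure_ofReal {α : ℝ} (hα : 0 < α) :
    ∫⁻ d, ENNReal.ofReal d ∂ProbabilityTheory.expMeasure α = ENNReal.ofReal (1 / α) := by
  have := ProbabilityTheory.isProbabilityMeasure_expMeasure hα
  rw [lintegral_eq_lintegral_meas_lt _ (ae_nonneg_expMeasure α) aemeasurable_id',
    ← lintegral_exp_neg_Ici hα, setLIntegral_congr Ioi_ae_eq_Ici]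
  refine setLIntegral_congr_fun measurableSet_Ici fun s hs => ?_
  have h := lintegral_expMeasure_tail (α := α) hs (f := fun _ => 1) measurable_const
  rw [lintegral_one, measure_univ, mul_one] at h
  have h2 : {a : ℝ | s < a} = Set.Ioi s := rfl
  rw [← h, h2, ← lintegral_indicator_one measurableSet_Ioi]
  rfl

lemma meanCycle_eq {α : ℝ} (hα : 0 < α) (Ξ : Measure (Set.Ioi (0 : ℝ) × X))
    [IsProbabilityMeasure Ξ] :
    meanCycle α Ξ = ENNReal.ofReal (1 / α) + ∫⁻ q, ENNReal.ofReal (q.1 : ℝ) ∂Ξ := by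
  have := ProbabilityTheory.isProbabilityMeasure_expMeasure hα
  have h : ∀ᵐ c ∂cycleLaw α Ξ, ENNReal.ofReal (cycleLength c) =
      ENNReal.ofReal c.1 + ENNReal.ofReal (c.2.1 : ℝ) := by
    filter_upwards [ae_cycleLaw_nonneg hα Ξ] with c hc
    exact ENNReal.ofReal_add hc (le_of_lt c.2.1.2)
  have hm1 : Measurable fun d : ℝ => ENNReal.ofReal d := by fun_prop
  have hm2 : Measurable fun q : Set.Ioi (0 : ℝ) × X => ENNReal.ofReal (q.1 : ℝ) := by fun_prop
  have hm1' : Measurable fun c : ℝ × (Set.Ioi (0 : ℝ) × X) => ENNReal.ofReal c.1 := by fun_prop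
  have hm2' : Measurable fun c : ℝ × (Set.Ioi (0 : ℝ) × X) => ENNReal.ofReal (c.2.1 : ℝ) := by
    fun_prop
  rw [meanCycle, lintegral_congr_ae h, lintegral_add_left hm1', cycleLaw,
    lintegral_prod _ hm1'.aemeasurable, lintegral_prod _ hm2'.aemeasurable]
  simp [lintegral_expMeasure_ofReal hα]

/-- The limit is rewritten through 1 + α𝔼[a] = α𝔼[T]. -/
lemma tendsto_dormantProb_ennreal {α : ℝ} (hα : 0 < α) (Ξ : Measure (Set.Ioi (0 : ℝ) × X))
    [IsProbabilityMeasure Ξ] (hΞ : ∫⁻ q, ENNReal.ofReal (q.1 : ℝ) ∂Ξ < ∞) :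
    Tendsto (dormantProb α Ξ) atTop (𝓝 (ENNReal.ofReal α * meanCycle α Ξ)⁻¹) := by
  have h := ENNReal.tendsto_ofReal (tendsto_dormantProb hα Ξ hΞ)
  have h1 : 0 < 1 + α * (∫⁻ q, ENNReal.ofReal (q.1 : ℝ) ∂Ξ).toReal := by positivity
  have h2 : ENNReal.ofReal (1 + α * (∫⁻ q, ENNReal.ofReal (q.1 : ℝ) ∂Ξ).toReal)⁻¹ =
      (ENNReal.ofReal α * meanCycle α Ξ)⁻¹ := by
    rw [ENNReal.ofReal_inv_of_pos h1, meanCycle_eq hα, mul_add, ← ENNReal.ofReal_mul hα.le,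
      mul_one_div_cancel hα.ne', ENNReal.ofReal_add zero_le_one (by positivity),
      ENNReal.ofReal_mul hα.le, ENNReal.ofReal_toReal hΞ.ne]
  rw [h2] at h
  refine h.congr fun t => ENNReal.ofReal_toReal ?_
  exact ne_top_of_le_ne_top ENNReal.one_ne_top (dormantProb_le_one hα Ξ t)

lemma meanCycle_ne_zero {α : ℝ} (hα : 0 < α) (Ξ : Measure (Set.Ioi (0 : ℝ) × X))
    [IsProbabilityMeasure Ξ] : meanCycle α Ξ ≠ 0 := by
  rw [meanCycle_eq hα]
  have : 0 < ENNReal.ofReal (1 / α) := ENNReal.ofReal_pos.2 (by positivity)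
  exact (this.trans_le le_self_add).ne'

/-- The sharp asymptotics of the partition function under the tilting condition. -/
theorem tendsto_partitionFn_of_isTilting {α : ℝ} (hα : 0 < α)
    (Ξ : Measure (Set.Ioi (0 : ℝ) × X)) [IsProbabilityMeasure Ξ]
    (hΞ : ∫⁻ q, ENNReal.ofReal (q.1 : ℝ) ∂Ξ < ∞) {E : X → EReal} (hE : Measurable E)
    (hE_top : ∀ x, E x ≠ ⊤) {lam : ℝ} (hlam : IsTilting α Ξ E lam) :
    0 < α + lam ∧ IsProbabilityMeasure (tiltedLaw α Ξ E lam) ∧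
      meanCycle (α + lam) (tiltedLaw α Ξ E lam) < ∞ ∧
      Tendsto (fun t : ℝ => partitionFn α Ξ E t * ENNReal.ofReal (Real.exp (-(lam * t)))) atTop
        (𝓝 (ENNReal.ofReal (α / (α + lam)) *
          (meanCycle α Ξ / meanCycle (α + lam) (tiltedLaw α Ξ E lam)))) := by
  have hpos : 0 < α + lam := pos_of_lintegral_tiltWeight_ne_top hα Ξ hE hE_top
    (by rw [hlam.1]; exact ENNReal.one_ne_top)
  have hprob : IsProbabilityMeasure (tiltedLaw α Ξ E lam) :=
    ⟨by rw [tiltedLaw_univ hα Ξ hE hpos, hlam.1]⟩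
  have hmean : meanCycle (α + lam) (tiltedLaw α Ξ E lam) < ∞ := by
    rw [meanCycle_tiltedLaw hα Ξ hE hpos]
    exact hlam.2
  refine ⟨hpos, hprob, hmean, ?_⟩
  have hΞ' : ∫⁻ q, ENNReal.ofReal (q.1 : ℝ) ∂tiltedLaw α Ξ E lam < ∞ := by
    rw [meanCycle_eq hpos] at hmean
    exact lt_of_le_of_lt le_add_self hmean
  have hmean0 : meanCycle α Ξ ≠ ∞ := by
    rw [meanCycle_eq hα]
    exact ENNReal.add_ne_top.2 ⟨ENNReal.ofReal_ne_top, hΞ.ne⟩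
  have hα0 : ENNReal.ofReal α ≠ 0 := (ENNReal.ofReal_pos.2 hα).ne'
  have hαl0 : ENNReal.ofReal (α + lam) ≠ 0 := (ENNReal.ofReal_pos.2 hpos).ne'
  have h1 := (tendsto_dormantProb_ennreal hα Ξ hΞ).inv
  have h2 := tendsto_dormantProb_ennreal hpos (tiltedLaw α Ξ E lam) hΞ'
  rw [inv_inv] at h1
  have h3 := ENNReal.Tendsto.mul h1
    (Or.inl (mul_ne_zero hα0 (meanCycle_ne_zero hα Ξ))) h2
    (Or.inr (ENNReal.mul_ne_top ENNReal.ofReal_ne_top hmean0))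
  have h4 : ENNReal.ofReal α * meanCycle α Ξ *
      (ENNReal.ofReal (α + lam) * meanCycle (α + lam) (tiltedLaw α Ξ E lam))⁻¹ =
      ENNReal.ofReal (α / (α + lam)) *
        (meanCycle α Ξ / meanCycle (α + lam) (tiltedLaw α Ξ E lam)) := by
    rw [ENNReal.mul_inv (Or.inl hαl0) (Or.inl ENNReal.ofReal_ne_top),
      ENNReal.ofReal_div_of_pos hpos, div_eq_mul_inv, div_eq_mul_inv]
    ring
  rw [h4] at h3
  refine h3.congr' ?_
  filter_upwards [eventually_ge_atTop 0] with t ht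
  rw [partitionFn_eq hα Ξ hE hE_top ht, dormantProb_tiltedLaw hα Ξ hE hpos]
  ring

/-- The Laplace transform of the weight of dormant paths. -/
lemma lintegral_exp_mul_dormantMass {α : ℝ} (hα : 0 < α) (Ξ : Measure (Set.Ioi (0 : ℝ) × X))
    [IsProbabilityMeasure Ξ] {E : X → EReal} (hE : Measurable E) {lam : ℝ} (h : 0 < α + lam) :
    ∫⁻ t, ENNReal.ofReal (Real.exp (-(lam * t))) * dormantMass α Ξ (stateWeight E) t =
      ENNReal.ofReal (1 / (α + lam)) *
        (1 - ∫⁻ c, tiltWeight E lam c ∂cycleLaw α Ξ)⁻¹ := by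
  have := isProbabilityMeasure_cycleLaw hα Ξ
  have hA := measurable_dormantTerm hα Ξ (measurable_stateWeight hE)
  have hm : ∀ n, Measurable fun t => ENNReal.ofReal (Real.exp (-(lam * t))) *
      dormantTerm α Ξ (stateWeight E) n t := fun n =>
    (by fun_prop : Measurable fun t : ℝ => ENNReal.ofReal (Real.exp (-(lam * t)))).mul (hA n)
  -- Each completed cycle is a convolution and contributes one factor m(lam). The geometric series
  -- also covers m(lam) ≥ 1, where truncated subtraction and inversion give ∞.
  have hterm : ∀ n, ∫⁻ t, ENNReal.ofReal (Real.exp (-(lam * t))) *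
      dormantTerm α Ξ (stateWeight E) n t =
      ENNReal.ofReal (1 / (α + lam)) * (∫⁻ c, tiltWeight E lam c ∂cycleLaw α Ξ) ^ n := by
    intro n
    induction n with
    | zero =>
      rw [pow_zero, mul_one, ← lintegral_exp_neg_Ici h, ← lintegral_indicator measurableSet_Ici]
      refine lintegral_congr fun t => ?_
      by_cases ht : 0 ≤ t
      · rw [dormantTerm, if_pos ht, Set.indicator_of_mem (Set.mem_Ici.2 ht),
          ← ENNReal.ofReal_mul (Real.exp_pos _).le, ← Real.exp_add]
        ring_nf
      · rw [dormantTerm, if_neg ht, Set.indicator_of_notMem (by simpa using ht), mul_zero]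
    | succ n ih =>
      have h1 : ∀ t, ENNReal.ofReal (Real.exp (-(lam * t))) *
          dormantTerm α Ξ (stateWeight E) (n + 1) t =
          ∫⁻ c, tiltWeight E lam c * (ENNReal.ofReal (Real.exp (-(lam * (t - cycleLength c)))) *
            dormantTerm α Ξ (stateWeight E) n (t - cycleLength c)) ∂cycleLaw α Ξ := by
        intro t
        rw [dormantTerm, ← lintegral_const_mul' _ _ ENNReal.ofReal_ne_top]
        refine lintegral_congr fun c => ?_
        rw [tiltWeight_eq,
          show -(lam * t) = -(lam * cycleLength c) + -(lam * (t - cycleLength c)) by ring,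
          Real.exp_add, ENNReal.ofReal_mul (Real.exp_pos _).le]
        ring
      simp_rw [h1]
      rw [lintegral_lintegral_swap]
      swap
      · exact (((measurable_tiltWeight hE lam).comp measurable_snd).mul ((hm n).comp
          (measurable_fst.sub (measurable_cycleLength.comp measurable_snd)))).aemeasurable
      rw [pow_succ, ← mul_assoc, ← ih, mul_comm, ← lintegral_mul_const _
        (measurable_tiltWeight hE lam)]
      refine lintegral_congr fun c => ?_
      have hmc : Measurable fun t => ENNReal.ofReal (Real.exp (-(lam * (t - cycleLength c)))) *
          dormantTerm α Ξ (stateWeight E) n (t - cycleLength c) :=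
        (hm n).comp (measurable_id.sub_const _)
      rw [lintegral_const_mul _ hmc]
      congr 1
      exact lintegral_sub_right_eq_self (fun t => ENNReal.ofReal (Real.exp (-(lam * t))) *
        dormantTerm α Ξ (stateWeight E) n t) (cycleLength c)
  simp_rw [dormantMass, ← ENNReal.tsum_mul_left]
  rw [lintegral_tsum fun n => (hm n).aemeasurable]
  simp_rw [hterm]
  rw [ENNReal.tsum_mul_left, ENNReal.tsum_geometric]

end Tilting

/-! ### Superadditive functions and the doubling condition. -/

section Superadditive

variable {L : ℝ → ℝ} {α : ℝ}

lemma nat_mul_add_le_of_superadditive (hL : ∀ s t, 0 < s → 0 < t → L s + L t ≤ L (s + t))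
    (n : ℕ) {s r : ℝ} (hs : 0 < s) (hr : 0 < r) : n * L s + L r ≤ L (n * s + r) := by
  induction n with
  | zero => simp
  | succ n ih =>
    have h := hL s (n * s + r) hs (by positivity)
    push_cast
    rw [show ((n : ℝ) + 1) * s + r = s + (n * s + r) by ring]
    linarith

/-- Cut t into blocks of length s and a remainder of length less than 2s; the constant absorbs the
error made on the remainder. -/
lemma exists_linear_lower_bound (hL : ∀ s t, 0 < s → 0 < t → L s + L t ≤ L (s + t))
    (hα : 0 ≤ α) (hlow : ∀ t, 0 < t → -(α * t) ≤ L t) {s : ℝ} (hs : 0 < s) :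
    ∃ K : ℝ, ∀ t, s ≤ t → L s / s * t - K ≤ L t := by
  refine ⟨2 * s * (|L s / s| + α), fun t ht => ?_⟩
  -- One block fewer than fits is used, so that the remainder stays strictly positive; the
  -- assumptions concern positive times only.
  obtain ⟨m, hm⟩ : ∃ m, ⌊t / s⌋₊ = m + 1 := by
    refine Nat.exists_eq_succ_of_ne_zero (Nat.pos_iff_ne_zero.1 (Nat.floor_pos.2 ?_))
    rwa [le_div_iff₀ hs, one_mul]
  have h1 : ((m : ℝ) + 1) * s ≤ t := by
    have := Nat.floor_le (div_nonneg (hs.le.trans ht) hs.le)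
    rw [hm, le_div_iff₀ hs] at this
    exact_mod_cast this
  have h2 : t < ((m : ℝ) + 2) * s := by
    have := Nat.lt_floor_add_one (t / s)
    rw [hm, div_lt_iff₀ hs] at this
    push_cast at this
    linarith
  have hr : 0 < t - m * s := by linarith
  have h3 := nat_mul_add_le_of_superadditive hL m hs hr
  rw [add_sub_cancel] at h3
  have h4 := hlow _ hr
  have h5 : (m : ℝ) * L s = L s / s * t - L s / s * (t - m * s) := by field_simp; ring
  have h6 : L s / s * (t - m * s) ≤ |L s / s| * (2 * s) :=
    mul_le_mul (le_abs_self _) (by linarith) hr.le (abs_nonneg _)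
  have h7 : α * (t - m * s) ≤ α * (2 * s) := mul_le_mul_of_nonneg_left (by linarith) hα
  linarith

/-- Fekete's lemma for superadditive functions on the half-line. -/
lemma tendsto_div_of_superadditive (hL : ∀ s t, 0 < s → 0 < t → L s + L t ≤ L (s + t))
    (hα : 0 ≤ α) (hlow : ∀ t, 0 < t → -(α * t) ≤ L t) :
    (∃ φ : ℝ, Tendsto (fun t => L t / t) atTop (𝓝 φ) ∧ ∀ t, 0 < t → L t ≤ φ * t) ∨
      Tendsto (fun t => L t / t) atTop atTop := by
  -- Every quotient L s / s bounds the lower limit from below, so the limit is the supremum of these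
  -- quotients, finite or not.
  have key : ∀ s, 0 < s → ∀ x, x < L s / s → ∀ᶠ t in atTop, x < L t / t := by
    intro s hs x hx
    obtain ⟨K, hK⟩ := exists_linear_lower_bound hL hα hlow hs
    have h1 : Tendsto (fun t : ℝ => L s / s - K / t) atTop (𝓝 (L s / s - 0)) :=
      (tendsto_const_nhds.div_atTop tendsto_id).const_sub _
    rw [sub_zero] at h1
    filter_upwards [h1.eventually_const_lt hx, eventually_ge_atTop s] with t ht hst
    have ht0 : 0 < t := hs.trans_le hst
    refine ht.trans_le ?_
    rw [le_div_iff₀ ht0, sub_mul, div_mul_cancel₀ _ ht0.ne']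
    exact hK t hst
  set S : Set ℝ := (fun t => L t / t) '' Set.Ioi 0 with hS
  by_cases hb : BddAbove S
  · left
    have hub : ∀ t, 0 < t → L t / t ≤ sSup S := fun t ht => le_csSup hb ⟨t, ht, rfl⟩
    refine ⟨sSup S, ?_, fun t ht => ?_⟩
    · rw [tendsto_order]
      constructor
      · intro x hx
        obtain ⟨_, ⟨s, hs, rfl⟩, hxs⟩ := exists_lt_of_lt_csSup (s := S)
          ⟨_, 1, Set.mem_Ioi.2 one_pos, rfl⟩ hx
        exact key s hs x hxs
      · intro x hx
        filter_upwards [eventually_gt_atTop 0] with t ht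
        exact (hub t ht).trans_lt hx
    · have := hub t ht
      rwa [div_le_iff₀ ht] at this
  · right
    rw [tendsto_atTop]
    intro x
    rw [not_bddAbove_iff] at hb
    obtain ⟨_, ⟨s, hs, rfl⟩, hxs⟩ := hb x
    exact (key s hs x hxs).mono fun t ht => ht.le

lemma doubling_iterate {K t₀ : ℝ} (ht₀ : 0 < t₀) (h : ∀ t, t₀ ≤ t → L (2 * t) ≤ 2 * L t + K)
    (n : ℕ) {t : ℝ} (ht : t₀ ≤ t) :
    L (2 ^ n * t) / (2 ^ n * t) + K / (2 ^ n * t) ≤ (L t + K) / t := by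
  have ht0 : 0 < t := ht₀.trans_le ht
  -- Adding K makes the doubling bound homogeneous: L(2t) + K ≤ 2(L t + K).
  have h1 : L (2 ^ n * t) + K ≤ 2 ^ n * (L t + K) := by
    induction n with
    | zero => simp
    | succ n ih =>
      have h2 : t₀ ≤ 2 ^ n * t :=
        ht.trans (le_mul_of_one_le_left ht0.le (one_le_pow₀ one_le_two))
      have h3 := h _ h2
      rw [pow_succ', mul_assoc, mul_assoc]
      linarith
  rw [← add_div, div_le_div_iff₀ (by positivity) ht0]
  calc (L (2 ^ n * t) + K) * t ≤ 2 ^ n * (L t + K) * t := by gcongr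
    _ = (L t + K) * (2 ^ n * t) := by ring

lemma tendsto_two_pow_mul {t : ℝ} (ht : 0 < t) :
    Tendsto (fun n : ℕ => (2 : ℝ) ^ n * t) atTop atTop :=
  (tendsto_pow_atTop_atTop_of_one_lt one_lt_two).atTop_mul_const ht

lemma le_add_of_doubling {K t₀ φ : ℝ} (ht₀ : 0 < t₀)
    (h : ∀ t, t₀ ≤ t → L (2 * t) ≤ 2 * L t + K)
    (hφ : Tendsto (fun t => L t / t) atTop (𝓝 φ)) {t : ℝ} (ht : t₀ ≤ t) : φ * t ≤ L t + K := by
  have ht0 : 0 < t := ht₀.trans_le ht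
  have h2 := tendsto_two_pow_mul ht0
  have h3 := (hφ.comp h2).add ((tendsto_const_nhds (x := K)).div_atTop h2)
  rw [add_zero] at h3
  have h4 := le_of_tendsto' h3 fun n => doubling_iterate ht₀ h n ht
  rwa [le_div_iff₀ ht0] at h4

lemma not_tendsto_atTop_of_doubling {K t₀ : ℝ} (ht₀ : 0 < t₀)
    (h : ∀ t, t₀ ≤ t → L (2 * t) ≤ 2 * L t + K) :
    ¬Tendsto (fun t => L t / t) atTop atTop := by
  intro hφ
  have h2 := tendsto_two_pow_mul ht₀
  have h3 := (hφ.comp h2).atTop_add ((tendsto_const_nhds (x := K)).div_atTop h2)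
  obtain ⟨n, hn⟩ := (h3.eventually_gt_atTop ((L t₀ + K) / t₀)).exists
  exact absurd (doubling_iterate ht₀ h n le_rfl) (not_le.2 hn)

end Superadditive

/-! ### Existence and identification of the exponential rate. -/

section FreeEnergy

variable {X : Type*} [MeasurableSpace X]

lemma ofReal_exp_le_dormantMass (α : ℝ) (Ξ : Measure (Set.Ioi (0 : ℝ) × X)) (w : X → ℝ≥0∞)
    {t : ℝ} (ht : 0 ≤ t) : ENNReal.ofReal (Real.exp (-(α * t))) ≤ dormantMass α Ξ w t := by
  have h : dormantTerm α Ξ w 0 t ≤ dormantMass α Ξ w t := ENNReal.le_tsum 0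
  rwa [dormantTerm, if_pos ht] at h

/-- The real-valued weight of dormant paths. -/
def dormantReal (α : ℝ) (Ξ : Measure (Set.Ioi (0 : ℝ) × X)) (w : X → ℝ≥0∞) (t : ℝ) : ℝ :=
  (dormantMass α Ξ w t).toReal

variable {α : ℝ} {Ξ : Measure (Set.Ioi (0 : ℝ) × X)} {E : X → EReal}

lemma dormantReal_pos {w : X → ℝ≥0∞} {t : ℝ} (ht : 0 ≤ t) (hfin : dormantMass α Ξ w t ≠ ∞) :
    0 < dormantReal α Ξ w t :=
  ENNReal.toReal_pos ((ENNReal.ofReal_pos.2 (Real.exp_pos _)).trans_le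
    (ofReal_exp_le_dormantMass α Ξ w ht)).ne' hfin

lemma exp_le_dormantReal {w : X → ℝ≥0∞} {t : ℝ} (ht : 0 ≤ t)
    (hfin : dormantMass α Ξ w t ≠ ∞) : Real.exp (-(α * t)) ≤ dormantReal α Ξ w t :=
  (ENNReal.ofReal_le_iff_le_toReal hfin).1 (ofReal_exp_le_dormantMass α Ξ w ht)

variable [IsProbabilityMeasure Ξ]

lemma dormantProb_ne_top (hα : 0 < α) (t : ℝ) : dormantMass α Ξ (fun _ => 1) t ≠ ∞ :=
  ne_top_of_le_ne_top ENNReal.one_ne_top (dormantProb_le_one hα Ξ t)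

/-- The dormancy probability is finite, so its inverse is nonzero and an infinite weight would force
an infinite partition function. Local boundedness enters the proof only through this finiteness. -/
lemma dormantMass_ne_top (hα : 0 < α) (hE : Measurable E) (hE_top : ∀ x, E x ≠ ⊤)
    (hZ : ∀ t : ℝ, 0 < t → ∃ C : ℝ≥0∞, C < ∞ ∧ ∀ s ∈ Set.Ioc 0 t, partitionFn α Ξ E s ≤ C)
    {t : ℝ} (ht : 0 < t) : dormantMass α Ξ (stateWeight E) t ≠ ∞ := by
  obtain ⟨C, hC, hCt⟩ := hZ t ht
  have h := (hCt t ⟨ht, le_rfl⟩).trans_lt hC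
  rw [partitionFn_eq hα Ξ hE hE_top ht.le] at h
  intro htop
  rw [htop, ENNReal.mul_top (ENNReal.inv_ne_zero.2 (show dormantProb α Ξ t ≠ ∞ from
    dormantProb_ne_top hα t))] at h
  exact lt_irrefl _ h

lemma partitionFn_eq_ofReal (hα : 0 < α) (hE : Measurable E) (hE_top : ∀ x, E x ≠ ⊤)
    (hfin : ∀ t, 0 < t → dormantMass α Ξ (stateWeight E) t ≠ ∞) {t : ℝ} (ht : 0 < t) :
    partitionFn α Ξ E t = ENNReal.ofReal
      (dormantReal α Ξ (stateWeight E) t / dormantReal α Ξ (fun _ => 1) t) := by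
  have hD := dormantReal_pos ht.le (dormantProb_ne_top (Ξ := Ξ) hα t)
  rw [partitionFn_eq hα Ξ hE hE_top ht.le, ENNReal.ofReal_div_of_pos hD, dormantReal, dormantReal,
    ENNReal.ofReal_toReal (hfin t ht), ENNReal.ofReal_toReal (dormantProb_ne_top hα t),
    ENNReal.div_eq_inv_mul, dormantProb]

lemma gibbsLaw_dormantAt_zero_eq_ofReal (hα : 0 < α) (hE : Measurable E)
    (hE_top : ∀ x, E x ≠ ⊤) (hfin : ∀ t, 0 < t → dormantMass α Ξ (stateWeight E) t ≠ ∞) {t : ℝ}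
    (ht : 0 < t) : gibbsLaw α Ξ E t (dormantAt X 0) = ENNReal.ofReal
      (dormantReal α Ξ (stateWeight E) t ^ 2 / dormantReal α Ξ (stateWeight E) (2 * t)) := by
  have h2t : 0 < 2 * t := by linarith
  have hD := dormantReal_pos h2t.le (dormantProb_ne_top (Ξ := Ξ) hα (2 * t))
  have hA := dormantReal_pos ht.le (hfin t ht)
  have hA2 := dormantReal_pos h2t.le (hfin _ h2t)
  have h1 : dormantProb α Ξ (2 * t) = ENNReal.ofReal (dormantReal α Ξ (fun _ => 1) (2 * t)) := by
    rw [dormantReal, ENNReal.ofReal_toReal (dormantProb_ne_top hα _), dormantProb]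
  have h2 : dormantMass α Ξ (stateWeight E) t =
      ENNReal.ofReal (dormantReal α Ξ (stateWeight E) t) := by
    rw [dormantReal, ENNReal.ofReal_toReal (hfin t ht)]
  rw [gibbsLaw_dormantAt_zero hα Ξ hE hE_top ht.le,
    partitionFn_eq_ofReal hα hE hE_top hfin h2t, h1, h2, ← ENNReal.ofReal_inv_of_pos hD,
    ← ENNReal.ofReal_inv_of_pos (by positivity), ← ENNReal.ofReal_pow hA.le,
    ← ENNReal.ofReal_mul (by positivity), ← ENNReal.ofReal_mul (by positivity)]
  congr 1
  field_simp

lemma tendsto_dormantReal_one (hα : 0 < α) (hΞ : ∫⁻ q, ENNReal.ofReal (q.1 : ℝ) ∂Ξ < ∞) :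
    ∃ p : ℝ, 0 < p ∧ Tendsto (dormantReal α Ξ fun _ => 1) atTop (𝓝 p) :=
  ⟨_, by positivity, tendsto_dormantProb hα Ξ hΞ⟩

lemma log_partitionFn_div (hα : 0 < α) (hE : Measurable E) (hE_top : ∀ x, E x ≠ ⊤)
    (hfin : ∀ t, 0 < t → dormantMass α Ξ (stateWeight E) t ≠ ∞) {t : ℝ} (ht : 0 < t) :
    ENNReal.log (partitionFn α Ξ E t) / (t : EReal) =
      ((Real.log (dormantReal α Ξ (stateWeight E) t) / t -
        Real.log (dormantReal α Ξ (fun _ => 1) t) / t : ℝ) : EReal) := by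
  have hD := dormantReal_pos ht.le (dormantProb_ne_top (Ξ := Ξ) hα t)
  have hA := dormantReal_pos ht.le (hfin t ht)
  rw [partitionFn_eq_ofReal hα hE hE_top hfin ht, ENNReal.log_ofReal_of_pos (div_pos hA hD),
    Real.log_div hA.ne' hD.ne', ← EReal.coe_div, sub_div]

/-- Existence of the free energy. -/
lemma freeEnergy_dichotomy (hα : 0 < α) (hΞ : ∫⁻ q, ENNReal.ofReal (q.1 : ℝ) ∂Ξ < ∞)
    (hE : Measurable E) (hE_top : ∀ x, E x ≠ ⊤)
    (hfin : ∀ t, 0 < t → dormantMass α Ξ (stateWeight E) t ≠ ∞) :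
    Tendsto (fun t : ℝ => ENNReal.log (partitionFn α Ξ E t) / (t : EReal)) atTop
        (𝓝 (freeEnergy α Ξ E)) ∧
      ((∃ φ : ℝ, freeEnergy α Ξ E = φ ∧
          Tendsto (fun t => Real.log (dormantReal α Ξ (stateWeight E) t) / t) atTop (𝓝 φ) ∧
          ∀ t, 0 < t → dormantReal α Ξ (stateWeight E) t ≤ Real.exp (φ * t)) ∨
        (freeEnergy α Ξ E = ⊤ ∧
          Tendsto (fun t => Real.log (dormantReal α Ξ (stateWeight E) t) / t) atTop atTop)) := by
  obtain ⟨p, hp, hD⟩ := tendsto_dormantReal_one hα hΞ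
  -- The normalising probability has a positive limit and does not affect the rate.
  have hlogD : Tendsto (fun t => Real.log (dormantReal α Ξ (fun _ => 1) t) / t) atTop (𝓝 0) :=
    ((Real.continuousAt_log hp.ne').tendsto.comp hD).div_atTop tendsto_id
  have hApos : ∀ t, 0 < t → 0 < dormantReal α Ξ (stateWeight E) t :=
    fun t ht => dormantReal_pos ht.le (hfin t ht)
  have hsup : ∀ s t, 0 < s → 0 < t → Real.log (dormantReal α Ξ (stateWeight E) s) +
      Real.log (dormantReal α Ξ (stateWeight E) t) ≤
        Real.log (dormantReal α Ξ (stateWeight E) (s + t)) := by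
    intro s t hs ht
    rw [← Real.log_mul (hApos s hs).ne' (hApos t ht).ne']
    refine Real.log_le_log (mul_pos (hApos s hs) (hApos t ht)) ?_
    rw [dormantReal, dormantReal, dormantReal, ← ENNReal.toReal_mul]
    exact ENNReal.toReal_mono (hfin _ (add_pos hs ht))
      (dormantMass_mul_le hα Ξ hE hE_top hs.le ht.le)
  have hlow : ∀ t, 0 < t → -(α * t) ≤ Real.log (dormantReal α Ξ (stateWeight E) t) :=
    fun t ht => (Real.le_log_iff_exp_le (hApos t ht)).2 (exp_le_dormantReal ht.le (hfin t ht))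
  have hev : (fun t : ℝ => ((Real.log (dormantReal α Ξ (stateWeight E) t) / t -
      Real.log (dormantReal α Ξ (fun _ => 1) t) / t : ℝ) : EReal)) =ᶠ[atTop]
        fun t : ℝ => ENNReal.log (partitionFn α Ξ E t) / (t : EReal) := by
    filter_upwards [eventually_gt_atTop 0] with t ht
    exact (log_partitionFn_div hα hE hE_top hfin ht).symm
  rcases tendsto_div_of_superadditive hsup hα.le hlow with ⟨φ, hφ, hle⟩ | htop
  · have h1 := hφ.sub hlogD
    rw [sub_zero] at h1
    have h2 := ((continuous_coe_real_ereal.tendsto φ).comp h1).congr' hev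
    have h3 : freeEnergy α Ξ E = φ := h2.limUnder_eq
    rw [h3]
    exact ⟨h2, Or.inl ⟨φ, rfl, hφ, fun t ht =>
      (Real.log_le_iff_le_exp (hApos t ht)).1 (hle t ht)⟩⟩
  · have h1 : Tendsto (fun t => Real.log (dormantReal α Ξ (stateWeight E) t) / t -
        Real.log (dormantReal α Ξ (fun _ => 1) t) / t) atTop atTop := by
      simp_rw [sub_eq_add_neg]
      exact htop.atTop_add hlogD.neg
    have h2 := (EReal.tendsto_coe_nhds_top_iff.2 h1).congr' hev
    have h3 : freeEnergy α Ξ E = ⊤ := h2.limUnder_eq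
    rw [h3]
    exact ⟨h2, Or.inr ⟨rfl, htop⟩⟩

/-- The tilting parameter is the free energy. -/
lemma freeEnergy_eq_of_tendsto (hα : 0 < α) (hE : Measurable E) (hE_top : ∀ x, E x ≠ ⊤)
    (hfin : ∀ t, 0 < t → dormantMass α Ξ (stateWeight E) t ≠ ∞) {lam : ℝ} {c : ℝ≥0∞}
    (hc0 : c ≠ 0) (hc : c ≠ ∞)
    (h : Tendsto (fun t : ℝ => partitionFn α Ξ E t * ENNReal.ofReal (Real.exp (-(lam * t))))
      atTop (𝓝 c)) : freeEnergy α Ξ E = lam := by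
  have hcpos : 0 < c.toReal := ENNReal.toReal_pos hc0 hc
  have h1 := (ENNReal.tendsto_toReal hc).comp h
  have h2 := ((Real.continuousAt_log hcpos.ne').tendsto.comp h1).div_atTop tendsto_id
  have h3 := (continuous_coe_real_ereal.tendsto _).comp (h2.add_const lam)
  rw [zero_add] at h3
  refine Tendsto.limUnder_eq (h3.congr' ?_)
  filter_upwards [eventually_gt_atTop 0] with t ht
  have hD := dormantReal_pos ht.le (dormantProb_ne_top (Ξ := Ξ) hα t)
  have hA := dormantReal_pos ht.le (hfin t ht)
  rw [log_partitionFn_div hα hE hE_top hfin ht]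
  simp only [Function.comp_apply, id]
  rw [partitionFn_eq_ofReal hα hE hE_top hfin ht, ← ENNReal.ofReal_mul (by positivity),
    ENNReal.toReal_ofReal (by positivity), Real.log_mul (by positivity) (by positivity),
    Real.log_exp, Real.log_div hA.ne' hD.ne']
  congr 1
  field_simp
  ring

end FreeEnergy

/-! ### The four conditions in terms of the weight of dormant paths. -/

section Criterion

variable {X : Type*} [MeasurableSpace X] {α : ℝ} {Ξ : Measure (Set.Ioi (0 : ℝ) × X)}
  {E : X → EReal}

lemma limsup_ofReal_lt_top_iff {f : ℝ → ℝ} :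
    limsup (fun t => ENNReal.ofReal (f t)) atTop < ∞ ↔ ∃ C > 0, ∀ᶠ t in atTop, f t ≤ C := by
  constructor
  · intro h
    obtain ⟨b, hb, hb'⟩ := exists_between h
    refine ⟨b.toReal + 1, by positivity, ?_⟩
    filter_upwards [eventually_lt_of_limsup_lt hb] with t ht
    have := (ENNReal.ofReal_le_iff_le_toReal hb'.ne).1 ht.le
    linarith
  · rintro ⟨C, -, hC⟩
    refine lt_of_le_of_lt (limsup_le_of_le (a := ENNReal.ofReal C) (by isBoundedDefault) ?_)
      ENNReal.ofReal_lt_top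
    exact hC.mono fun t ht => ENNReal.ofReal_le_ofReal ht

lemma zero_lt_liminf_ofReal_iff {f : ℝ → ℝ} :
    0 < liminf (fun t => ENNReal.ofReal (f t)) atTop ↔ ∃ c > 0, ∀ᶠ t in atTop, c ≤ f t := by
  constructor
  · intro h
    obtain ⟨b, hb, hb'⟩ := exists_between h
    have hbt : b ≠ ∞ := hb'.ne_top
    refine ⟨b.toReal, ENNReal.toReal_pos hb.ne' hbt, ?_⟩
    filter_upwards [eventually_lt_of_lt_liminf hb'] with t ht
    exact ((ENNReal.lt_ofReal_iff_toReal_lt hbt).1 ht).le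
  · rintro ⟨c, hc, hf⟩
    refine (ENNReal.ofReal_pos.2 hc).trans_le (le_liminf_of_le (by isBoundedDefault) ?_)
    exact hf.mono fun t ht => ENNReal.ofReal_le_ofReal ht

variable [IsProbabilityMeasure Ξ]

/-- As the parameter decreases to φ the weights increase, since T > 0, so monotone convergence
applies even when the limit is infinite. It is used with f = 1 and f = T. -/
lemma tendsto_lintegral_tiltWeight (hα : 0 < α) (hE : Measurable E)
    {f : ℝ × (Set.Ioi (0 : ℝ) × X) → ℝ} (hf : Measurable f) (φ : ℝ) :
    Tendsto (fun n : ℕ => ∫⁻ c, ENNReal.ofReal (f c) * tiltWeight E (φ + 1 / ((n : ℝ) + 1)) c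
      ∂cycleLaw α Ξ) atTop
      (𝓝 (∫⁻ c, ENNReal.ofReal (f c) * tiltWeight E φ c ∂cycleLaw α Ξ)) := by
  refine lintegral_tendsto_of_tendsto_of_monotone
    (fun n => (hf.ennreal_ofReal.mul (measurable_tiltWeight hE _)).aemeasurable) ?_ ?_
  · filter_upwards [ae_pos_cycleLength hα Ξ] with c hc n m hnm
    simp_rw [tiltWeight_eq]
    gcongr
  · refine ae_of_all _ fun c => ?_
    refine ENNReal.Tendsto.const_mul ?_ (Or.inr ENNReal.ofReal_ne_top)
    simp_rw [tiltWeight_eq]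
    refine ENNReal.Tendsto.mul_const ?_ (Or.inl (ENNReal.ofReal_pos.2 (Real.exp_pos _)).ne')
    refine ENNReal.tendsto_ofReal ((Real.continuous_exp.tendsto _).comp ?_)
    have h := (tendsto_one_div_add_atTop_nhds_zero_nat (𝕜 := ℝ)).const_add φ
    rw [add_zero] at h
    exact (h.mul_const _).neg

-- This is 1 + x ≤ e^x at x = (lam - φ)T, multiplied by the weight at lam. Integrated, it bounds the
-- tilted mean of T by a difference quotient.
omit [MeasurableSpace X] in
lemma tiltWeight_add_le {lam φ : ℝ} (h : φ ≤ lam) (c : ℝ × (Set.Ioi (0 : ℝ) × X))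
    (hc : 0 ≤ cycleLength c) :
    tiltWeight E lam c +
      ENNReal.ofReal (lam - φ) * (ENNReal.ofReal (cycleLength c) * tiltWeight E lam c) ≤
        tiltWeight E φ c := by
  have h0 : 0 ≤ lam - φ := sub_nonneg.2 h
  have h1 : Real.exp (-(lam * cycleLength c)) +
      (lam - φ) * (cycleLength c * Real.exp (-(lam * cycleLength c))) ≤
        Real.exp (-(φ * cycleLength c)) := by
    rw [show -(φ * cycleLength c) = -(lam * cycleLength c) + (lam - φ) * cycleLength c by ring,
      Real.exp_add]
    have := Real.add_one_le_exp ((lam - φ) * cycleLength c)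
    nlinarith [Real.exp_pos (-(lam * cycleLength c))]
  simp_rw [tiltWeight_eq, ← mul_assoc]
  rw [← add_mul]
  gcongr
  rw [← ENNReal.ofReal_mul h0, ← ENNReal.ofReal_mul (by positivity),
    ← ENNReal.ofReal_add (by positivity) (by positivity), mul_assoc]
  exact ENNReal.ofReal_le_ofReal h1

/-- Two-sided exponential bounds on the weight of dormant paths control the Laplace transform of
the cycle length. -/
lemma one_sub_lintegral_tiltWeight_le (hα : 0 < α) (hE : Measurable E) {φ κ : ℝ} (hκ : 0 < κ)
    (hup : ∀ t, 0 < t → dormantMass α Ξ (stateWeight E) t ≤ ENNReal.ofReal (Real.exp (φ * t)))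
    (hlow : ∀ t, 0 ≤ t →
      ENNReal.ofReal (κ * Real.exp (φ * t)) ≤ dormantMass α Ξ (stateWeight E) t)
    {lam : ℝ} (hlam : φ < lam) (hpos : 0 < α + lam) :
    ∫⁻ c, tiltWeight E lam c ∂cycleLaw α Ξ < 1 ∧
      1 - (∫⁻ c, tiltWeight E lam c ∂cycleLaw α Ξ).toReal ≤ (lam - φ) / (κ * (α + lam)) := by
  have hd : 0 < lam - φ := sub_pos.2 hlam
  have hL := lintegral_exp_mul_dormantMass hα Ξ hE hpos
  set m := ∫⁻ c, tiltWeight E lam c ∂cycleLaw α Ξ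
  have h1 : ∫⁻ t, ENNReal.ofReal (Real.exp (-(lam * t))) * dormantMass α Ξ (stateWeight E) t ≤
      ENNReal.ofReal (1 / (lam - φ)) := by
    rw [← lintegral_exp_neg_Ici hd, ← lintegral_indicator measurableSet_Ici]
    refine lintegral_mono_ae ?_
    filter_upwards [Measure.ae_ne volume (0 : ℝ)] with t ht0
    rcases lt_or_gt_of_ne ht0 with ht | ht
    · rw [dormantMass_of_neg hα Ξ _ ht, mul_zero]
      exact zero_le
    · rw [Set.indicator_of_mem (Set.mem_Ici.2 ht.le)]
      refine (mul_le_mul_right (hup t ht) _).trans ?_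
      rw [← ENNReal.ofReal_mul (Real.exp_pos _).le, ← Real.exp_add]
      refine ENNReal.ofReal_le_ofReal (Real.exp_le_exp.2 (le_of_eq (by ring)))
  have h2 : ENNReal.ofReal (κ / (lam - φ)) ≤
      ∫⁻ t, ENNReal.ofReal (Real.exp (-(lam * t))) * dormantMass α Ξ (stateWeight E) t := by
    rw [div_eq_mul_one_div, ENNReal.ofReal_mul hκ.le, ← lintegral_exp_neg_Ici hd,
      ← lintegral_const_mul' _ _ ENNReal.ofReal_ne_top, ← lintegral_indicator measurableSet_Ici]
    refine lintegral_mono fun t => ?_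
    by_cases ht : 0 ≤ t
    · rw [Set.indicator_of_mem (Set.mem_Ici.2 ht)]
      refine le_trans ?_ (mul_le_mul_right (hlow t ht) _)
      rw [← ENNReal.ofReal_mul hκ.le, ← ENNReal.ofReal_mul (Real.exp_pos _).le, mul_left_comm,
        ← Real.exp_add]
      refine ENNReal.ofReal_le_ofReal (le_of_eq ?_)
      ring_nf
    · rw [Set.indicator_of_notMem (by simpa using ht)]
      exact zero_le
  -- Otherwise the Laplace transform would be infinite, against the upper bound 1/(lam - φ).
  have hm : m < 1 := by
    by_contra hm
    rw [tsub_eq_zero_of_le (not_lt.1 hm), ENNReal.inv_zero, ENNReal.mul_top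
      (ENNReal.ofReal_pos.2 (by positivity)).ne'] at hL
    rw [hL, top_le_iff] at h1
    exact ENNReal.ofReal_ne_top h1
  refine ⟨hm, ?_⟩
  have hmr : 0 < 1 - m.toReal := by
    have := (ENNReal.toReal_lt_toReal hm.ne_top ENNReal.one_ne_top).2 hm
    rw [ENNReal.toReal_one] at this
    linarith
  have h3 : 1 - m = ENNReal.ofReal (1 - m.toReal) := by
    rw [ENNReal.ofReal_sub _ ENNReal.toReal_nonneg, ENNReal.ofReal_one,
      ENNReal.ofReal_toReal hm.ne_top]
  rw [hL, h3, ← ENNReal.ofReal_inv_of_pos hmr, ← ENNReal.ofReal_mul (by positivity),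
    ENNReal.ofReal_le_ofReal_iff (by positivity), ← one_div, div_mul_div_comm, one_mul,
    div_le_div_iff₀ hd (by positivity)] at h2
  rw [le_div_iff₀ (by positivity)]
  linarith

/-- Let lam decrease to φ in the Laplace estimate. The gap 1 - m(lam) vanishes, so m(φ) = 1; being
linear in lam - φ, it also bounds the mean of T uniformly. -/
lemma isTilting_of_bounds (hα : 0 < α) (hE : Measurable E) (hE_top : ∀ x, E x ≠ ⊤) {φ κ : ℝ}
    (hκ : 0 < κ)
    (hup : ∀ t, 0 < t → dormantMass α Ξ (stateWeight E) t ≤ ENNReal.ofReal (Real.exp (φ * t)))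
    (hlow : ∀ t, 0 ≤ t →
      ENNReal.ofReal (κ * Real.exp (φ * t)) ≤ dormantMass α Ξ (stateWeight E) t) :
    IsTilting α Ξ E φ := by
  -- Comparing both bounds on the weight at time 1 gives only the weak inequality, enough to use
  -- parameters above φ. Strictness follows once m(φ) is known to be finite.
  have hαφ : 0 ≤ α + φ := by
    have h1 := (ofReal_exp_le_dormantMass α Ξ (stateWeight E) zero_le_one).trans (hup 1 one_pos)
    rw [ENNReal.ofReal_le_ofReal_iff (Real.exp_pos _).le, Real.exp_le_exp] at h1
    linarith
  have hn : ∀ n : ℕ, 0 < 1 / ((n : ℝ) + 1) := fun n => Nat.one_div_pos_of_nat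
  have hb := fun n : ℕ => one_sub_lintegral_tiltWeight_le hα hE hκ hup hlow
    (lam := φ + 1 / ((n : ℝ) + 1)) (by linarith [hn n]) (by linarith [hn n])
  have hm := tendsto_lintegral_tiltWeight (Ξ := Ξ) hα hE (f := fun _ => 1) measurable_const φ
  simp only [ENNReal.ofReal_one, one_mul] at hm
  have hmφ : ∫⁻ c, tiltWeight E φ c ∂cycleLaw α Ξ ≤ 1 := le_of_tendsto' hm fun n => (hb n).1.le
  have hmφ' := ne_top_of_le_ne_top ENNReal.one_ne_top hmφ
  have hpos : 0 < α + φ := pos_of_lintegral_tiltWeight_ne_top hα Ξ hE hE_top hmφ'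
  have hbound : ∀ n : ℕ, 1 - (∫⁻ c, tiltWeight E (φ + 1 / ((n : ℝ) + 1)) c ∂cycleLaw α Ξ).toReal ≤
      1 / ((n : ℝ) + 1) * (1 / (κ * (α + φ))) := by
    intro n
    refine (hb n).2.trans ?_
    rw [add_sub_cancel_left, mul_one_div]
    have := hn n
    gcongr
    linarith
  have hone : ∫⁻ c, tiltWeight E φ c ∂cycleLaw α Ξ = 1 := by
    have h1 := (ENNReal.tendsto_toReal hmφ').comp hm
    have h2 : Tendsto (fun n : ℕ => 1 / ((n : ℝ) + 1) * (1 / (κ * (α + φ)))) atTop (𝓝 0) := by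
      simpa using (tendsto_one_div_add_atTop_nhds_zero_nat (𝕜 := ℝ)).mul_const (1 / (κ * (α + φ)))
    have h3 := le_of_tendsto_of_tendsto' (h1.const_sub 1) h2 hbound
    have h4 := ENNReal.toReal_mono ENNReal.one_ne_top hmφ
    rw [ENNReal.toReal_one] at h4
    rw [← ENNReal.toReal_eq_one_iff]
    linarith
  refine ⟨hone, ?_⟩
  have hT := tendsto_lintegral_tiltWeight (Ξ := Ξ) hα hE measurable_cycleLength φ
  refine lt_of_le_of_lt (le_of_tendsto' hT fun n => ?_)
    (ENNReal.ofReal_lt_top (r := 1 / (κ * (α + φ))))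
  set lam := φ + 1 / ((n : ℝ) + 1) with hlam
  -- The right side is m(φ) = 1, so (lam - φ) times the mean of T at lam is at most 1 - m(lam).
  have h1 : ∫⁻ c, tiltWeight E lam c ∂cycleLaw α Ξ + ENNReal.ofReal (lam - φ) *
      ∫⁻ c, ENNReal.ofReal (cycleLength c) * tiltWeight E lam c ∂cycleLaw α Ξ ≤ 1 := by
    rw [← hone, ← lintegral_const_mul' _ _ ENNReal.ofReal_ne_top,
      ← lintegral_add_left (measurable_tiltWeight hE lam)]
    refine lintegral_mono_ae ?_
    filter_upwards [ae_pos_cycleLength hα Ξ] with c hc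
    exact tiltWeight_add_le (by linarith [hn n]) c hc.le
  have hlt := (hb n).1
  have h2 := ENNReal.le_sub_of_add_le_left hlt.ne_top h1
  have h3 : 1 - ∫⁻ c, tiltWeight E lam c ∂cycleLaw α Ξ ≤
      ENNReal.ofReal (lam - φ) * ENNReal.ofReal (1 / (κ * (α + φ))) := by
    rw [← ENNReal.ofReal_toReal hlt.ne_top, ← ENNReal.ofReal_one,
      ← ENNReal.ofReal_sub _ ENNReal.toReal_nonneg, ← ENNReal.ofReal_mul (by linarith [hn n]),
      hlam, add_sub_cancel_left]
    exact ENNReal.ofReal_le_ofReal (hbound n)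
  have h4 : ENNReal.ofReal (lam - φ) ≠ 0 := by
    rw [hlam, add_sub_cancel_left]
    exact (ENNReal.ofReal_pos.2 (hn n)).ne'
  exact (ENNReal.mul_le_mul_iff_right h4 ENNReal.ofReal_ne_top).1 (h2.trans h3)

/-- The normalisations contribute D(t)²/D(2t), which tends to the positive limit p of D; the
constants p/2 and 2p bracket it. -/
lemma limsup_partitionFn_ratio_lt_top_iff (hα : 0 < α)
    (hΞ : ∫⁻ q, ENNReal.ofReal (q.1 : ℝ) ∂Ξ < ∞) (hE : Measurable E) (hE_top : ∀ x, E x ≠ ⊤)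
    (hfin : ∀ t, 0 < t → dormantMass α Ξ (stateWeight E) t ≠ ∞) :
    limsup (fun t : ℝ => partitionFn α Ξ E (2 * t) / partitionFn α Ξ E t ^ 2) atTop < ∞ ↔
      ∃ C > 0, ∀ᶠ t in atTop, dormantReal α Ξ (stateWeight E) (2 * t) ≤
        C * dormantReal α Ξ (stateWeight E) t ^ 2 := by
  obtain ⟨p, hp, hD⟩ := tendsto_dormantReal_one hα hΞ
  set a := dormantReal α Ξ (stateWeight E)
  set d := dormantReal α Ξ fun _ => 1
  have ha : ∀ t, 0 < t → 0 < a t := fun t ht => dormantReal_pos ht.le (hfin t ht)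
  have hdpos : ∀ t, 0 < t → 0 < d t := fun t ht => dormantReal_pos ht.le (dormantProb_ne_top hα t)
  have h2 : Tendsto (fun t : ℝ => 2 * t) atTop atTop := tendsto_id.const_mul_atTop two_pos
  have hr : Tendsto (fun t => d t ^ 2 / d (2 * t)) atTop (𝓝 p) := by
    have := (hD.pow 2).div (hD.comp h2) hp.ne'
    rwa [sq, mul_div_assoc, div_self hp.ne', mul_one] at this
  have hfun : (fun t : ℝ => partitionFn α Ξ E (2 * t) / partitionFn α Ξ E t ^ 2) =ᶠ[atTop]
      fun t => ENNReal.ofReal (a (2 * t) / a t ^ 2 * (d t ^ 2 / d (2 * t))) := by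
    filter_upwards [eventually_gt_atTop 0] with t ht
    have h2t : 0 < 2 * t := by linarith
    have ha1 := ha t ht
    have ha2 := ha _ h2t
    have hd1 := hdpos t ht
    have hd2 := hdpos _ h2t
    rw [partitionFn_eq_ofReal hα hE hE_top hfin ht, partitionFn_eq_ofReal hα hE hE_top hfin h2t,
      ← ENNReal.ofReal_pow (by positivity), ← ENNReal.ofReal_div_of_pos (by positivity)]
    congr 1
    change a (2 * t) / d (2 * t) / (a t / d t) ^ 2 = _
    field_simp
  rw [limsup_congr hfun, limsup_ofReal_lt_top_iff]
  constructor
  · rintro ⟨C, hC, h⟩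
    refine ⟨C / (p / 2), by positivity, ?_⟩
    filter_upwards [h, eventually_gt_atTop 0, hr.eventually_const_lt (half_lt_self hp)]
      with t h3 ht h4
    have ha1 := ha t ht
    have ha2 := ha (2 * t) (by linarith)
    rw [← div_le_iff₀ (by positivity), le_div_iff₀ (by positivity)]
    refine le_trans ?_ h3
    gcongr
  · rintro ⟨C, hC, h⟩
    refine ⟨C * (2 * p), by positivity, ?_⟩
    filter_upwards [h, eventually_gt_atTop 0,
      hr.eventually_lt_const (show p < 2 * p by linarith)] with t h3 ht h4
    have ha1 := ha t ht
    have hd1 := hdpos t ht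
    have hd2 := hdpos (2 * t) (by linarith)
    rw [← div_le_iff₀ (by positivity)] at h3
    gcongr

lemma liminf_gibbsLaw_pos_iff (hα : 0 < α) (hE : Measurable E) (hE_top : ∀ x, E x ≠ ⊤)
    (hfin : ∀ t, 0 < t → dormantMass α Ξ (stateWeight E) t ≠ ∞) :
    0 < liminf (fun t : ℝ => gibbsLaw α Ξ E t (dormantAt X 0)) atTop ↔
      ∃ C > 0, ∀ᶠ t in atTop, dormantReal α Ξ (stateWeight E) (2 * t) ≤
        C * dormantReal α Ξ (stateWeight E) t ^ 2 := by
  have hfun : (fun t : ℝ => gibbsLaw α Ξ E t (dormantAt X 0)) =ᶠ[atTop] fun t => ENNReal.ofReal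
      (dormantReal α Ξ (stateWeight E) t ^ 2 / dormantReal α Ξ (stateWeight E) (2 * t)) := by
    filter_upwards [eventually_gt_atTop 0] with t ht
    exact gibbsLaw_dormantAt_zero_eq_ofReal hα hE hE_top hfin ht
  rw [liminf_congr hfun, zero_lt_liminf_ofReal_iff]
  constructor
  · rintro ⟨c, hc, h⟩
    refine ⟨c⁻¹, inv_pos.2 hc, ?_⟩
    filter_upwards [h, eventually_gt_atTop 0] with t h1 ht
    rw [le_div_iff₀ (dormantReal_pos (by linarith) (hfin _ (by linarith)))] at h1
    rwa [← div_eq_inv_mul, le_div_iff₀ hc, mul_comm]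
  · rintro ⟨C, hC, h⟩
    refine ⟨C⁻¹, inv_pos.2 hC, ?_⟩
    filter_upwards [h, eventually_gt_atTop 0] with t h1 ht
    rw [le_div_iff₀ (dormantReal_pos (by linarith) (hfin _ (by linarith))), ← div_eq_inv_mul,
      div_le_iff₀ hC]
    linarith

lemma liminf_partitionFn_pos_iff (hα : 0 < α) (hΞ : ∫⁻ q, ENNReal.ofReal (q.1 : ℝ) ∂Ξ < ∞)
    (hE : Measurable E) (hE_top : ∀ x, E x ≠ ⊤)
    (hfin : ∀ t, 0 < t → dormantMass α Ξ (stateWeight E) t ≠ ∞) {φ : ℝ}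
    (hφ : freeEnergy α Ξ E = φ) :
    0 < liminf (fun t : ℝ => partitionFn α Ξ E t *
        EReal.exp (-(freeEnergy α Ξ E * (t : EReal)))) atTop ↔
      ∃ c > 0, ∀ᶠ t in atTop, c * Real.exp (φ * t) ≤ dormantReal α Ξ (stateWeight E) t := by
  obtain ⟨p, hp, hD⟩ := tendsto_dormantReal_one hα hΞ
  set d := dormantReal α Ξ fun _ => 1
  have hdpos : ∀ t, 0 < t → 0 < d t := fun t ht => dormantReal_pos ht.le (dormantProb_ne_top hα t)
  have hfun : (fun t : ℝ => partitionFn α Ξ E t *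
      EReal.exp (-(freeEnergy α Ξ E * (t : EReal)))) =ᶠ[atTop] fun t => ENNReal.ofReal
        (dormantReal α Ξ (stateWeight E) t / d t * Real.exp (-(φ * t))) := by
    filter_upwards [eventually_gt_atTop 0] with t ht
    have ha := dormantReal_pos ht.le (hfin t ht)
    have hd := hdpos t ht
    rw [hφ, partitionFn_eq_ofReal hα hE hE_top hfin ht, ← EReal.coe_mul, ← EReal.coe_neg,
      EReal.exp_coe, ENNReal.ofReal_mul (by positivity)]
  rw [liminf_congr hfun, zero_lt_liminf_ofReal_iff]
  constructor
  · rintro ⟨c, hc, h⟩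
    refine ⟨c * (p / 2), by positivity, ?_⟩
    filter_upwards [h, eventually_gt_atTop 0, hD.eventually_const_lt (half_lt_self hp)]
      with t h1 ht h2
    have hd := hdpos t ht
    rw [Real.exp_neg, ← div_eq_mul_inv, le_div_iff₀ (Real.exp_pos _), le_div_iff₀ hd] at h1
    refine le_trans ?_ h1
    rw [mul_right_comm]
    gcongr
  · rintro ⟨c, hc, h⟩
    refine ⟨c / (2 * p), by positivity, ?_⟩
    filter_upwards [h, eventually_gt_atTop 0,
      hD.eventually_lt_const (show p < 2 * p by linarith)] with t h1 ht h2
    have hd := hdpos t ht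
    rw [Real.exp_neg, ← div_eq_mul_inv, div_div, div_le_div_iff₀ (by positivity) (by positivity)]
    have ha := dormantReal_pos ht.le (hfin t ht)
    calc c * (d t * Real.exp (φ * t)) = c * Real.exp (φ * t) * d t := by ring
      _ ≤ dormantReal α Ξ (stateWeight E) t * (2 * p) := by gcongr

omit [IsProbabilityMeasure Ξ] in
lemma liminf_partitionFn_of_eq_top (h : freeEnergy α Ξ E = ⊤) :
    liminf (fun t : ℝ => partitionFn α Ξ E t *
      EReal.exp (-(freeEnergy α Ξ E * (t : EReal)))) atTop = 0 := by
  have hfun : (fun t : ℝ => partitionFn α Ξ E t *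
      EReal.exp (-(freeEnergy α Ξ E * (t : EReal)))) =ᶠ[atTop] fun _ => 0 := by
    filter_upwards [eventually_gt_atTop 0] with t ht
    rw [h, EReal.top_mul_coe_of_pos ht, EReal.neg_top, EReal.exp_bot, mul_zero]
  rw [liminf_congr hfun, liminf_const]

end Criterion

end AlternatingProcess

end

/-! ### The equivalences and the sharp asymptotics. -/

open AlternatingProcess in
theorem mainTheorem6 {X : Type*} [TopologicalSpace X] [PolishSpace X] [MeasurableSpace X]
    [BorelSpace X] (α : ℝ) (hα : 0 < α)
    (Ξ : Measure (Set.Ioi (0 : ℝ) × X)) [IsProbabilityMeasure Ξ]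
    (hΞ : ∫⁻ q, ENNReal.ofReal (q.1 : ℝ) ∂Ξ < ∞)
    (E : X → EReal) (hE : Measurable E) (hE_top : ∀ x, E x ≠ ⊤)
    (hZ : ∀ t : ℝ, 0 < t → ∃ C : ℝ≥0∞, C < ∞ ∧ ∀ s ∈ Set.Ioc 0 t, partitionFn α Ξ E s ≤ C) :
    Tendsto (fun t : ℝ => ENNReal.log (partitionFn α Ξ E t) / (t : EReal)) atTop
        (𝓝 (freeEnergy α Ξ E)) ∧
      freeEnergy α Ξ E ≠ ⊥ ∧
      List.TFAE
        [∃ lam : ℝ, IsTilting α Ξ E lam,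
          limsup (fun t : ℝ => partitionFn α Ξ E (2 * t) / partitionFn α Ξ E t ^ 2) atTop < ∞,
          0 < liminf (fun t : ℝ => gibbsLaw α Ξ E t (dormantAt X 0)) atTop,
          0 < liminf (fun t : ℝ => partitionFn α Ξ E t *
            EReal.exp (-(freeEnergy α Ξ E * (t : EReal)))) atTop] ∧
      ((∃ lam : ℝ, IsTilting α Ξ E lam) →
        ∃ lam : ℝ, freeEnergy α Ξ E = (lam : EReal) ∧ IsTilting α Ξ E lam ∧
          (∀ lam' : ℝ, IsTilting α Ξ E lam' → lam' = lam) ∧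
          0 < α + lam ∧ IsProbabilityMeasure (tiltedLaw α Ξ E lam) ∧
          meanCycle (α + lam) (tiltedLaw α Ξ E lam) < ∞ ∧
          Tendsto (fun t : ℝ => partitionFn α Ξ E t * ENNReal.ofReal (Real.exp (-(lam * t)))) atTop
            (𝓝 (ENNReal.ofReal (α / (α + lam)) *
              (meanCycle α Ξ / meanCycle (α + lam) (tiltedLaw α Ξ E lam))))) := by
  have hfin : ∀ t, 0 < t → dormantMass α Ξ (stateWeight E) t ≠ ∞ :=
    fun t ht => dormantMass_ne_top hα hE hE_top hZ ht
  have hapos : ∀ t, 0 < t → 0 < dormantReal α Ξ (stateWeight E) t :=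
    fun t ht => dormantReal_pos ht.le (hfin t ht)
  obtain ⟨hlim, hcases⟩ := freeEnergy_dichotomy hα hΞ hE hE_top hfin
  have hmean : meanCycle α Ξ ≠ ∞ := by
    rw [meanCycle_eq hα]
    exact ENNReal.add_ne_top.2 ⟨ENNReal.ofReal_ne_top, hΞ.ne⟩
  have htilt : ∀ lam, IsTilting α Ξ E lam → freeEnergy α Ξ E = (lam : EReal) ∧
      0 < liminf (fun t : ℝ => partitionFn α Ξ E t *
        EReal.exp (-(freeEnergy α Ξ E * (t : EReal)))) atTop := by
    intro lam hlam
    obtain ⟨hpos, hprob, hm, ht⟩ := tendsto_partitionFn_of_isTilting hα Ξ hΞ hE hE_top hlam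
    have hc0 : ENNReal.ofReal (α / (α + lam)) *
        (meanCycle α Ξ / meanCycle (α + lam) (tiltedLaw α Ξ E lam)) ≠ 0 :=
      mul_ne_zero (ENNReal.ofReal_pos.2 (by positivity)).ne'
        (ENNReal.div_ne_zero.2 ⟨meanCycle_ne_zero hα Ξ, hm.ne⟩)
    have hc : ENNReal.ofReal (α / (α + lam)) *
        (meanCycle α Ξ / meanCycle (α + lam) (tiltedLaw α Ξ E lam)) ≠ ∞ :=
      ENNReal.mul_ne_top ENNReal.ofReal_ne_top
        (ENNReal.div_ne_top hmean (meanCycle_ne_zero hpos _))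
    have hφ := freeEnergy_eq_of_tendsto hα hE hE_top hfin hc0 hc ht
    refine ⟨hφ, ?_⟩
    have hfun : ∀ t : ℝ, partitionFn α Ξ E t * EReal.exp (-(freeEnergy α Ξ E * (t : EReal))) =
        partitionFn α Ξ E t * ENNReal.ofReal (Real.exp (-(lam * t))) := fun t => by
      rw [hφ, ← EReal.coe_mul, ← EReal.coe_neg, EReal.exp_coe]
    simp_rw [hfun]
    rw [ht.liminf_eq]
    exact pos_iff_ne_zero.2 hc0
  refine ⟨hlim, ?_, ?_, ?_⟩
  · rcases hcases with ⟨φ, hφ, -⟩ | ⟨htop, -⟩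
    · rw [hφ]; exact EReal.coe_ne_bot φ
    · rw [htop]; exact top_ne_bot
  · tfae_have 1 → 4 := fun ⟨lam, hlam⟩ => (htilt lam hlam).2
    tfae_have 2 ↔ 3 := by
      rw [limsup_partitionFn_ratio_lt_top_iff hα hΞ hE hE_top hfin,
        liminf_gibbsLaw_pos_iff hα hE hE_top hfin]
    tfae_have 3 → 4 := by
      rw [liminf_gibbsLaw_pos_iff hα hE hE_top hfin]
      rintro ⟨C, hC, h⟩
      obtain ⟨t₁, ht₁⟩ := eventually_atTop.1 h
      have ht₀ : 0 < max t₁ 1 := lt_max_of_lt_right one_pos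
      have hlog : ∀ t, max t₁ 1 ≤ t → Real.log (dormantReal α Ξ (stateWeight E) (2 * t)) ≤
          2 * Real.log (dormantReal α Ξ (stateWeight E) t) + Real.log C := by
        intro t ht
        have ht0 : 0 < t := ht₀.trans_le ht
        have ha := hapos t ht0
        have h1 := Real.log_le_log (hapos (2 * t) (by linarith)) (ht₁ t ((le_max_left _ _).trans ht))
        rw [Real.log_mul hC.ne' (by positivity), Real.log_pow] at h1
        push_cast at h1
        linarith
      rcases hcases with ⟨φ, hφ, hφlim, -⟩ | ⟨-, htop⟩
      · rw [liminf_partitionFn_pos_iff hα hΞ hE hE_top hfin hφ]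
        refine ⟨C⁻¹, inv_pos.2 hC, ?_⟩
        filter_upwards [eventually_ge_atTop (max t₁ 1)] with t ht
        have ha := hapos t (ht₀.trans_le ht)
        have h1 := le_add_of_doubling ht₀ hlog hφlim ht
        rw [← Real.log_mul ha.ne' hC.ne', Real.le_log_iff_exp_le (by positivity)] at h1
        rwa [← div_eq_inv_mul, div_le_iff₀ hC]
      · exact absurd htop (not_tendsto_atTop_of_doubling ht₀ hlog)
    tfae_have 4 → 3 := by
      intro h
      rcases hcases with ⟨φ, hφ, -, hup⟩ | ⟨htop, -⟩
      · rw [liminf_partitionFn_pos_iff hα hΞ hE hE_top hfin hφ] at h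
        obtain ⟨c, hc, h⟩ := h
        rw [liminf_gibbsLaw_pos_iff hα hE hE_top hfin]
        -- From A(2t) ≤ e^{2φt} = c⁻²(c e^{φt})² ≤ c⁻²A(t)².
        refine ⟨(c ^ 2)⁻¹, by positivity, ?_⟩
        filter_upwards [h, eventually_gt_atTop 0] with t h1 ht
        rw [← div_eq_inv_mul, le_div_iff₀ (by positivity)]
        calc dormantReal α Ξ (stateWeight E) (2 * t) * c ^ 2
            ≤ Real.exp (φ * (2 * t)) * c ^ 2 := by
              gcongr
              exact hup _ (by linarith)
          _ = (c * Real.exp (φ * t)) ^ 2 := by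
              rw [mul_pow, ← Real.exp_nat_mul, mul_comm]
              push_cast
              ring_nf
          _ ≤ _ := by gcongr
      · rw [liminf_partitionFn_of_eq_top htop] at h
        exact absurd h (lt_irrefl _)
    tfae_have 4 → 1 := by
      intro h
      rcases hcases with ⟨φ, hφ, -, hup⟩ | ⟨htop, -⟩
      · rw [liminf_partitionFn_pos_iff hα hΞ hE hE_top hfin hφ] at h
        obtain ⟨c, hc, h⟩ := h
        obtain ⟨t₁, ht₁⟩ := eventually_atTop.1 h
        set t₀ := max t₁ 1
        have ht₀ : 0 < t₀ := lt_max_of_lt_right one_pos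
        -- The constant c works only beyond t₀. Before t₀, paths with no activation yet give A(t) ≥
        -- e^{-αt}, which dominates e^{-|α+φ|t₀}e^{φt}.
        refine ⟨φ, isTilting_of_bounds hα hE hE_top (κ := min c (Real.exp (-(|α + φ| * t₀))))
          (lt_min hc (Real.exp_pos _)) (fun t ht => ?_) fun t ht => ?_⟩
        · exact (ENNReal.le_ofReal_iff_toReal_le (hfin t ht) (Real.exp_pos _).le).2 (hup t ht)
        · rcases le_total t₀ t with h1 | h1
          · rw [ENNReal.ofReal_le_iff_le_toReal (hfin t (ht₀.trans_le h1))]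
            refine le_trans ?_ (ht₁ t ((le_max_left _ _).trans h1))
            gcongr
            exact min_le_left _ _
          · refine le_trans (ENNReal.ofReal_le_ofReal ?_)
              (ofReal_exp_le_dormantMass α Ξ (stateWeight E) ht)
            refine (mul_le_mul_of_nonneg_right (min_le_right _ _) (Real.exp_pos _).le).trans ?_
            rw [← Real.exp_add, Real.exp_le_exp]
            have h2 : (α + φ) * t ≤ |α + φ| * t₀ :=
              mul_le_mul (le_abs_self _) h1 ht (abs_nonneg _)
            linarith
      · rw [liminf_partitionFn_of_eq_top htop] at h
        exact absurd h (lt_irrefl _)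
    tfae_finish
  · rintro ⟨lam, hlam⟩
    obtain ⟨hpos, hprob, hm, ht⟩ := tendsto_partitionFn_of_isTilting hα Ξ hΞ hE hE_top hlam
    have hφ := (htilt lam hlam).1
    refine ⟨lam, hφ, hlam, fun lam' hlam' => ?_, hpos, hprob, hm, ht⟩
    -- Every tilting parameter equals the free energy, hence uniqueness.
    have hφ' := (htilt lam' hlam').1
    rw [hφ] at hφ'
    exact (EReal.coe_injective hφ').symm
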